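/- **Definitions.** For a finite matroid $\mathcal M=(E,\mathcal I)$ with rank function $\mathrm{rk}$, the fractional covering number is $\beta_{\mathcal M}:=\max_{\emptyset\neq A\subseteq E}\frac{|A|}{\mathrm{rk}(A)}\in[0,\infty]$, with $|A|/0=\infty$ (so $\beta_{\mathcal M}=\infty$ if $\mathcal M$ has a loop) and $\beta_{\mathcal M}=0$ if $E=\emptyset$. A dynamic matroid is a sequence of finite matroids $\mathcal M_0,\mathcal M_1,\dots,\mathcal M_T$ in which $\mathcal M_{t+1}=(E_{t+1},\mathcal I_{t+1})$ arises from $\mathcal M_t=(E_t,\mathcal I_t)$ by one update: either the deletion of an element $e\in E_t$ (then $E_{t+1}=E_t\setminus\{e\}$, $\mathcal I_{t+1}=\{I\in\mathcal I_t: e\notin I\}$), or the insertion of an element $e\notin E_t$ (then $E_{t+1}=E_t\cup\{e\}$ and $\mathcal I_{t+1}=\mathcal I_t\cup\mathcal I_e$ is a matroid on $E_{t+1}$, where every $I\in\mathcal I_e$ contains $e$). A fully dynamic algorithm is given the initial ground set and may preprocess $\mathcal M_0$ through its rank oracle; then, for each update, it is told the element that is inserted or deleted and may adaptively query the rank oracle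 of the current matroid. It maintains a number (its estimate); its cost per update is the number of rank queries. A randomized algorithm may depend on a random seed; against an oblivious adversary the whole dynamic matroid is fixed independently of the seed. **Theorem.** For every constant $c>0$ there is a constant $C=C(c)>0$ such that for every universe of elements, every integer $n\ge 1$ and every $\varepsilon\in(0,1/2)$ there is a randomized fully dynamic algorithm with the following properties. 1. On every dynamic matroid, of any length, that at any moment contains at most $n$ elements, for every random seed, each update uses at most $C\log^6 n/\varepsilon^8$ rank queries in the worst case. 2. For every dynamic matroid $\mathcal M_0,\dots,\mathcal M_T$ that at any moment contains at most $n$ elements, fixed in advance by an oblivious adversary, with $T\le n^c$ updates, with probability at least $1-n^{-c}$ over the seed the estimate $\tilde\beta_t$ maintained after $t$ updates satisfies $(1-\varepsilon)\beta_{\mathcal M_t}\le\tilde\beta_t\le(1+\varepsilon)\beta_{\mathcal M_t}$ simultaneously for all $0\le t\le T$. -/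

import Mathlib

open scoped ENNReal

universe u v

namespace DynMatroid

/-- The fractional covering number `max {|A| / rk(A) : ∅ ≠ A ⊆ E}` of a (finite) matroid. It is an
extended nonnegative real: it is `∞` exactly when the matroid has a loop (a nonempty set of rank
`0`), and the maximum over the empty family, for the empty ground set, is `0`. -/
noncomputable def coveringNumber {α : Type u} (M : Matroid α) : ℝ≥0∞ :=
  ⨆ A ∈ {A : Set α | A ⊆ M.E ∧ A.Nonempty}, (A.encard : ℝ≥0∞) / (M.eRk A : ℝ≥0∞)

/-- `x` is a `(1 ± ε)`-approximation of `b`. -/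
def IsApprox (ε : ℝ) (x b : ℝ≥0∞) : Prop :=
  ENNReal.ofReal (1 - ε) * b ≤ x ∧ x ≤ ENNReal.ofReal (1 + ε) * b

/-- What the algorithm is told when the ground set changes. -/
inductive Update (α : Type u) : Type u
  | insert (e : α)
  | delete (e : α)

/-- `M'` arises from `M` by the given update. A deletion restricts the matroid to the remaining
elements. An insertion may lead to any matroid on the enlarged ground set whose independent sets
avoiding the new element are those of `M`. -/
def Update.Step {α : Type u} (M : Matroid α) : Update α → Matroid α → Prop
  | .insert e, M' => e ∉ M.E ∧ M'.E = Insert.insert e M.E ∧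
      ∀ I : Set α, e ∉ I → (M'.Indep I ↔ M.Indep I)
  | .delete e, M' => e ∈ M.E ∧ M'.E = M.E \ {e} ∧
      ∀ I : Set α, M'.Indep I ↔ M.Indep I ∧ e ∉ I

/-- The matroids `M 0, …, M T` form a dynamic matroid with updates `w 0, …, w (T - 1)`, which at
any moment contains at most `n` elements. -/
structure IsDynamicMatroid {α : Type u} (n T : ℕ) (M : ℕ → Matroid α) (w : ℕ → Update α) :
    Prop where
  step : ∀ t < T, (w t).Step (M t) (M (t + 1))
  card_le : ∀ t ≤ T, (M t).E.encard ≤ n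

/-- An adaptive computation with access to a rank oracle: it either stops with a result, or asks
for the rank of a set `A` and continues depending on the answer. Only the queries are counted. -/
inductive RankProgram (α : Type u) (β : Type v) : Type (max u v)
  | ret (b : β)
  | query (A : Set α) (next : ℕ → RankProgram α β)

namespace RankProgram

variable {α : Type u} {β : Type v}

/-- The result of running the program on `M`. A query `A` is answered by the rank of `A` in `M`
(that is, of `A ∩ M.E`). -/
noncomputable def result (M : Matroid α) : RankProgram α β → β
  | ret b => b
  | query A next => (next (M.eRk A).toNat).result M

/-- The number of rank queries made when running the program on `M`. -/
noncomputable def numQueries (M : Matroid α) : RankProgram α β → ℕ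
  | ret _ => 0
  | query A next => (next (M.eRk A).toNat).numQueries M + 1

end RankProgram

/-- A deterministic fully dynamic algorithm that maintains a number. `init` builds the data
structure from the initial ground set, `update` processes one update, `output` is the maintained
value; `init` and `update` have access to the rank oracle of the current matroid only. -/
structure Algorithm (α : Type u) where
  State : Type u
  init : Set α → RankProgram α State
  update : State → Update α → RankProgram α State
  output : State → ℝ≥0∞

namespace Algorithm

variable {α : Type u}

/-- The state after the first `t` updates. -/
noncomputable def state (𝒜 : Algorithm α) (M : ℕ → Matroid α) (w : ℕ → Update α) : ℕ → 𝒜.State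
  | 0 => (𝒜.init (M 0).E).result (M 0)
  | t + 1 => (𝒜.update (state 𝒜 M w t) (w t)).result (M (t + 1))

/-- The value maintained after the first `t` updates. -/
noncomputable def estimate (𝒜 : Algorithm α) (M : ℕ → Matroid α) (w : ℕ → Update α) (t : ℕ) :
    ℝ≥0∞ :=
  𝒜.output (𝒜.state M w t)

/-- The number of rank queries made while processing the update `w t`. -/
noncomputable def updateQueries (𝒜 : Algorithm α) (M : ℕ → Matroid α) (w : ℕ → Update α)
    (t : ℕ) : ℕ :=
  (𝒜.update (𝒜.state M w t) (w t)).numQueries (M (t + 1))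

end Algorithm

/-- A randomized algorithm: a random seed, drawn from a probability space before the first update,
selects a deterministic algorithm. -/
structure RandomizedAlgorithm (α : Type u) where
  Seed : Type u
  [measurableSpace : MeasurableSpace Seed]
  law : MeasureTheory.Measure Seed
  [isProbabilityMeasure : MeasureTheory.IsProbabilityMeasure law]
  run : Seed → Algorithm α

attribute [instance] RandomizedAlgorithm.measurableSpace
attribute [instance] RandomizedAlgorithm.isProbabilityMeasure

end DynMatroid

/-!
The algorithm is a greedy packing of bases, run on random samples of the ground set.

*Static estimate.* Choose bases `B₁, …, B_k` one after the other, each greedily with respect to the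
loads, that is, to the numbers of preceding bases that contain the elements (`load`). The bases meet
a set `A` in at most `k rk(A)` elements altogether, so some element has load at most `k rk(A) / |A|`,
and `k` divided by the least load is at least the covering number `β` (`div_le_loadEstimate`).
Conversely, the greedy base has at least the share `1 / β` of every weight that decreases with the
load, by Abel summation, as `rk(P) ≥ |P| / β` for all initial segments `P`. Applied to the weight
`exp (-η load)`, this makes the potential `∑ exp (-η load)` decay exponentially, so that
`k ≈ β log n / ε²` bases suffice for a `(1 + ε)`-approximation (`loadEstimate_le`).

*Updates.* With ties broken by a fixed linear order, the packing is determined by the matroid alone.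
The insertion of `e` can only decrease the loads of the other elements (`load_insert_le`), while the
sum of all loads does not decrease. Hence the loads of the first `i` bases change for at most `i`
old elements (`card_changed_le`), and the next base is contained in a known set with at most `i + 1`
further elements; for a deletion, it contains a known set and has at most `i + 1` further elements.
On initial segments of the order, the rank differs from the number of known elements exactly by the
number of errors so far, so that each error is found by a bisection with `log n` rank queries
(`correctBase_spec`). This costs about `k² log n` queries per update.

*Sampling.* To keep `k ≈ log² n / ε⁴`, every element gets a uniform random label, and a packing is
kept for each of the `log n` samples of the elements with label at most `p = 2⁻ʲ`. If `p β` is at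
least a multiple of `log n / ε²`, then the covering number of the sample is close to `p β`: the
densest set keeps its density by a Chernoff bound, and no flat of rank `i` becomes too dense, since
there are at most `n ^ i` such flats, each of which fails with probability `n ^ (-a i)`
(`measure_not_isGoodSample_le`). The first sample, by decreasing rate, whose estimate is below a
threshold has the right rate (`isApprox_estimate_of_good`). Loops are recorded separately, with one
query for each insertion.
-/

namespace DynMatroid

open Finset

/-! ### Rank functions and greedy bases -/

/-- The axioms of a matroid rank function on finite sets, in their local form. -/
structure IsRankFunction {α : Type u} [DecidableEq α] (r : Finset α → ℕ) : Prop where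
  empty : r ∅ = 0
  le_insert : ∀ X x, r X ≤ r (insert x X)
  insert_le : ∀ X x, r (insert x X) ≤ r X + 1
  insert_eq_of_subset : ∀ X Y x, X ⊆ Y → r (insert x X) = r X → r (insert x Y) = r Y

section Greedy

variable {α : Type u} [DecidableEq α] {κ : Type v} [LinearOrder κ] {r : Finset α → ℕ}

lemma IsRankFunction.mono (hr : IsRankFunction r) {X Y : Finset α} (h : X ⊆ Y) : r X ≤ r Y := by
  have key : ∀ Z : Finset α, r X ≤ r (X ∪ Z) := by
    intro Z
    induction Z using Finset.induction_on with
    | empty => simp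
    | insert z Z _ ih =>
      rw [union_insert]
      exact ih.trans (hr.le_insert _ _)
  simpa [union_eq_right.2 h] using key Y

lemma IsRankFunction.le_card (hr : IsRankFunction r) (X : Finset α) : r X ≤ #X := by
  induction X using Finset.induction_on with
  | empty => simp [hr.empty]
  | insert z Z hz ih =>
    rw [card_insert_of_notMem hz]
    have := hr.insert_le Z z
    omega

lemma IsRankFunction.union_eq (hr : IsRankFunction r) {Y Z : Finset α}
    (h : ∀ z ∈ Z, r (insert z Y) = r Y) : r (Y ∪ Z) = r Y := by
  induction Z using Finset.induction_on with
  | empty => simp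
  | insert z Z _ ih =>
    rw [union_insert, hr.insert_eq_of_subset Y (Y ∪ Z) z subset_union_left
      (h z (mem_insert_self _ _))]
    exact ih fun y hy => h y (mem_insert_of_mem hy)

/-- The base of `A` that the greedy algorithm finds when it processes the elements by increasing
key `k`: it consists of the elements that are not spanned by the elements of smaller key. -/
def greedyBase (r : Finset α → ℕ) (k : α → κ) (A : Finset α) : Finset α :=
  {x ∈ A | r {y ∈ A | k y < k x} < r (insert x {y ∈ A | k y < k x})}

lemma greedyBase_subset (r : Finset α → ℕ) (k : α → κ) (A : Finset α) : greedyBase r k A ⊆ A :=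
  filter_subset _ _

/-- An element of a greedy base stays in the greedy base if fewer elements come before it. -/
lemma mem_greedyBase_of_subset (hr : IsRankFunction r) {k k' : α → κ} {A A' : Finset α} {x : α}
    (hx : x ∈ A) (hsub : {y ∈ A | k y < k x} ⊆ {y ∈ A' | k' y < k' x})
    (h : x ∈ greedyBase r k' A') : x ∈ greedyBase r k A := by
  simp only [greedyBase, mem_filter] at h ⊢
  refine ⟨hx, lt_of_le_of_ne (hr.le_insert _ _) fun heq => ?_⟩
  exact h.2.ne' (hr.insert_eq_of_subset _ _ x hsub heq.symm)

lemma greedyBase_inter_subset (hr : IsRankFunction r) {k : α → κ} {A X : Finset α} (hX : X ⊆ A) :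
    greedyBase r k A ∩ X ⊆ greedyBase r k X := by
  intro x hx
  rw [mem_inter] at hx
  exact mem_greedyBase_of_subset hr hx.2 (filter_subset_filter _ hX) hx.1

lemma greedyBase_inter_of_isLower {k : α → κ} {A D : Finset α} (hD : D ⊆ A)
    (hlow : ∀ x ∈ D, ∀ y ∈ A, k y < k x → y ∈ D) :
    greedyBase r k A ∩ D = greedyBase r k D := by
  ext x
  have hb : x ∈ D → {y ∈ A | k y < k x} = {y ∈ D | k y < k x} := by
    intro hx
    ext y
    simp only [mem_filter]
    exact ⟨fun h => ⟨hlow x hx y h.1 h.2, h.2⟩, fun h => ⟨hD h.1, h.2⟩⟩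
  simp only [greedyBase, mem_inter, mem_filter]
  constructor
  · rintro ⟨⟨_, h⟩, hx⟩
    rw [hb hx] at h
    exact ⟨hx, h⟩
  · rintro ⟨hx, h⟩
    rw [← hb hx] at h
    exact ⟨⟨hD hx, h⟩, hx⟩

lemma card_greedyBase (hr : IsRankFunction r) {k : α → κ} (hk : Function.Injective k)
    (A : Finset α) : #(greedyBase r k A) = r A := by
  induction A using Finset.induction_on_max_value k with
  | empty => simp [greedyBase, hr.empty]
  | insert m D hm hmax ih =>
    have hlt : ∀ x ∈ D, k x < k m := fun x hx =>
      lt_of_le_of_ne (hmax x hx) fun h => hm (hk h ▸ hx)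
    have hbelow : {y ∈ insert m D | k y < k m} = D := by
      ext y
      simp only [mem_filter, mem_insert]
      constructor
      · rintro ⟨rfl | h, h'⟩
        · exact absurd h' (lt_irrefl _)
        · exact h
      · exact fun h => ⟨Or.inr h, hlt y h⟩
    have hD : greedyBase r k (insert m D) ∩ D = greedyBase r k D := by
      refine greedyBase_inter_of_isLower (subset_insert _ _) fun x hx y hy hyx => ?_
      rcases mem_insert.1 hy with rfl | hy
      · exact absurd (hyx.trans (hlt x hx)) (lt_irrefl _)
      · exact hy
    have hmem : m ∈ greedyBase r k (insert m D) ↔ r D < r (insert m D) := by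
      simp only [greedyBase, mem_filter, hbelow, mem_insert_self, true_and]
    have hnot : m ∉ greedyBase r k D := fun h => hm (greedyBase_subset _ _ _ h)
    by_cases h : r D < r (insert m D)
    · have : greedyBase r k (insert m D) = insert m (greedyBase r k D) := by
        rw [← hD]
        ext y
        simp only [mem_insert, mem_inter]
        constructor
        · intro hy
          rcases mem_insert.1 (greedyBase_subset _ _ _ hy) with h1 | h1
          · exact Or.inl h1
          · exact Or.inr ⟨hy, h1⟩
        · rintro (rfl | hy)
          · exact hmem.2 h
          · exact hy.1
      rw [this, card_insert_of_notMem hnot, ih]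
      have := hr.insert_le D m
      omega
    · have : greedyBase r k (insert m D) = greedyBase r k D := by
        rw [← hD, eq_comm, inter_eq_left]
        intro y hy
        rcases mem_insert.1 (greedyBase_subset _ _ _ hy) with rfl | h1
        · exact absurd (hmem.1 hy) h
        · exact h1
      rw [this, ih]
      have := hr.le_insert D m
      omega

/-- Abel summation: if `f` has nonnegative sums over all initial segments of the order given by
the keys, then so has its product with a nonnegative weight that decreases along the order. -/
lemma sum_mul_nonneg_of_initial_sums {k : α → κ} (hk : Function.Injective k) {w f : α → ℝ}
    (hw : ∀ x y, k x ≤ k y → w y ≤ w x) (hw0 : ∀ x, 0 ≤ w x) (A : Finset α)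
    (hf : ∀ D ⊆ A, (∀ x ∈ D, ∀ y ∈ A, k y < k x → y ∈ D) → 0 ≤ ∑ x ∈ D, f x) :
    0 ≤ ∑ x ∈ A, f x * w x := by
  -- The induction needs the stronger claim with a lower bound `c` of the weight.
  suffices h : ∀ c : ℝ, (∀ x ∈ A, c ≤ w x) → c * ∑ x ∈ A, f x ≤ ∑ x ∈ A, f x * w x by
    simpa using h 0 fun x _ => hw0 x
  induction A using Finset.induction_on_max_value k with
  | empty => simp
  | insert m D hm hmax ih =>
    intro c hc
    have hlt : ∀ x ∈ D, k x < k m := fun x hx =>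
      lt_of_le_of_ne (hmax x hx) fun h => hm (hk h ▸ hx)
    have ih' := ih (fun D' hD' hlow => hf D' (hD'.trans (subset_insert _ _))
      fun x hx y hy hyx => by
        rcases mem_insert.1 hy with rfl | hy
        · exact absurd (hyx.trans (hlt x (hD' hx))) (lt_irrefl _)
        · exact hlow x hx y hy hyx) (w m) fun x hx => hw x m (hmax x hx)
    have htot := hf (insert m D) Subset.rfl fun _ _ y hy _ => hy
    have hcm := hc m (mem_insert_self _ _)
    rw [sum_insert hm] at htot ⊢
    rw [sum_insert hm]
    nlinarith

lemma card_greedyBase_inter_le (hr : IsRankFunction r) {k : α → κ} (hk : Function.Injective k)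
    {A X : Finset α} (hX : X ⊆ A) : #(greedyBase r k A ∩ X) ≤ r X :=
  (card_le_card (greedyBase_inter_subset hr hX)).trans (card_greedyBase hr hk X).le

lemma rank_greedyBase (hr : IsRankFunction r) {k : α → κ} (hk : Function.Injective k)
    (A : Finset α) : r (greedyBase r k A) = r A := by
  refine le_antisymm (hr.mono (greedyBase_subset _ _ _)) ?_
  have := card_greedyBase_inter_le hr hk (greedyBase_subset r k A)
  rwa [inter_self, card_greedyBase hr hk] at this

/-- The greedy base has at least the average share of a weight that decreases with the key. -/
lemma sum_le_mul_sum_greedyBase (hr : IsRankFunction r) {k : α → κ} (hk : Function.Injective k)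
    {w : α → ℝ} (hw : ∀ x y, k x ≤ k y → w y ≤ w x) (hw0 : ∀ x, 0 ≤ w x) {A : Finset α} {b : ℝ}
    (hb : ∀ X ⊆ A, (#X : ℝ) ≤ b * r X) :
    ∑ x ∈ A, w x ≤ b * ∑ x ∈ greedyBase r k A, w x := by
  have h := sum_mul_nonneg_of_initial_sums hk (f := fun x =>
    b * (if x ∈ greedyBase r k A then 1 else 0) - 1) hw hw0 A fun D hD hlow => by
      rw [sum_sub_distrib, ← mul_sum, sum_boole, filter_mem_eq_inter, inter_comm,
        greedyBase_inter_of_isLower hD hlow, card_greedyBase hr hk]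
      simpa using hb D hD
  simp only [sub_mul, one_mul, mul_assoc, ite_mul, zero_mul, sum_sub_distrib, ← mul_sum] at h
  rw [← sum_filter, filter_mem_eq_inter, inter_eq_right.2 (greedyBase_subset _ _ _)] at h
  linarith

lemma greedyBase_congr {r' : Finset α → ℕ} {k : α → κ} {A : Finset α}
    (h : ∀ X ⊆ A, r X = r' X) : greedyBase r k A = greedyBase r' k A := by
  refine filter_congr fun x hx => ?_
  rw [h _ (filter_subset _ _), h _ (insert_subset hx (filter_subset _ _))]

end Greedy

/-! ### Greedy packings of bases and their loads -/

section Load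

/-- Elements are compared by their load, and ties are broken by the order of the universe. -/
def loadKey {α : Type u} (l : α → ℕ) (x : α) : ℕ ×ₗ α := toLex (l x, x)

lemma loadKey_injective {α : Type u} (l : α → ℕ) : Function.Injective (loadKey l) := by
  intro x y h
  simpa [loadKey] using congrArg (fun z => (ofLex z).2) h

variable {α : Type u} [LinearOrder α] {r : Finset α → ℕ}

lemma loadKey_lt_iff {l : α → ℕ} {x y : α} :
    loadKey l x < loadKey l y ↔ l x < l y ∨ l x = l y ∧ x < y := by
  simp [loadKey, Prod.Lex.toLex_lt_toLex]

/-- `load r A i x` is the number of the first `i` bases of the greedy packing of `A` that contain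
`x`. Each base of the packing is greedy with respect to the loads caused by the preceding ones. -/
def load (r : Finset α → ℕ) (A : Finset α) : ℕ → α → ℕ
  | 0 => fun _ => 0
  | i + 1 => fun x => load r A i x +
      if x ∈ greedyBase r (loadKey (load r A i)) A then 1 else 0

lemma load_succ (r : Finset α → ℕ) (A : Finset α) (i : ℕ) (x : α) :
    load r A (i + 1) x = load r A i x +
      if x ∈ greedyBase r (loadKey (load r A i)) A then 1 else 0 := rfl

lemma load_le (r : Finset α → ℕ) (A : Finset α) (i : ℕ) (x : α) : load r A i x ≤ i := by
  induction i with
  | zero => simp [load]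
  | succ i ih =>
    rw [load_succ]
    split_ifs <;> omega

lemma load_congr {r' : Finset α → ℕ} {A : Finset α} (h : ∀ X ⊆ A, r X = r' X) (i : ℕ) :
    load r A i = load r' A i := by
  induction i with
  | zero => rfl
  | succ i ih =>
    funext x
    rw [load_succ, load_succ, ih, greedyBase_congr h]

lemma sum_load_eq (r : Finset α → ℕ) {A X : Finset α} (i : ℕ) :
    ∑ x ∈ X, load r A (i + 1) x =
      ∑ x ∈ X, load r A i x + #(greedyBase r (loadKey (load r A i)) A ∩ X) := by
  simp only [load_succ, sum_add_distrib, sum_boole, filter_mem_eq_inter, Nat.cast_id]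
  rw [inter_comm]

lemma sum_load (hr : IsRankFunction r) (A : Finset α) (i : ℕ) :
    ∑ x ∈ A, load r A i x = i * r A := by
  induction i with
  | zero => simp [load]
  | succ i ih =>
    rw [sum_load_eq, ih, inter_eq_left.2 (greedyBase_subset _ _ _),
      card_greedyBase hr (loadKey_injective _)]
    ring

lemma sum_load_le (hr : IsRankFunction r) {A X : Finset α} (hX : X ⊆ A) (i : ℕ) :
    ∑ x ∈ X, load r A i x ≤ i * r X := by
  induction i with
  | zero => simp [load]
  | succ i ih =>
    rw [sum_load_eq]
    have := card_greedyBase_inter_le hr (loadKey_injective (load r A i)) hX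
    linarith

/-- If the load of `x` is not affected by `e`, then at least as many elements come before `x` in the
presence of `e` as in its absence. -/
lemma mem_greedyBase_of_load_eq (hr : IsRankFunction r) {A : Finset α} {e x : α} {i : ℕ}
    (hx : x ∈ A) (hle : ∀ y ∈ A, load r (insert e A) i y ≤ load r A i y)
    (heq : load r (insert e A) i x = load r A i x)
    (h : x ∈ greedyBase r (loadKey (load r (insert e A) i)) (insert e A)) :
    x ∈ greedyBase r (loadKey (load r A i)) A := by
  refine mem_greedyBase_of_subset hr hx (fun y hy => ?_) h
  simp only [mem_filter, loadKey_lt_iff] at hy ⊢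
  refine ⟨mem_insert_of_mem hy.1, ?_⟩
  have := hle y hy.1
  rcases hy.2 with h | h
  · left; omega
  · rcases this.lt_or_eq with h' | h'
    · left; omega
    · right; exact ⟨by omega, h.2⟩

/-- A new element can only decrease the loads of the other elements. -/
lemma load_insert_le (hr : IsRankFunction r) (A : Finset α) (e : α) (i : ℕ) :
    ∀ x ∈ A, load r (insert e A) i x ≤ load r A i x := by
  induction i with
  | zero => simp [load]
  | succ i ih =>
    intro x hx
    rw [load_succ, load_succ]
    rcases (ih x hx).lt_or_eq with h | h
    · split_ifs <;> omega
    · have := mem_greedyBase_of_load_eq hr hx ih h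
      split_ifs <;> first | omega | tauto

/-- The elements of `A` whose load after `i` bases is affected by the element `e`. -/
def changed (r : Finset α → ℕ) (A : Finset α) (e : α) (i : ℕ) : Finset α :=
  {x ∈ A | load r (insert e A) i x ≠ load r A i x}

/-- A new element affects the loads of few other elements: these loads only decrease, in total by
at most the load of the new element, as the sum of all loads does not decrease. -/
lemma card_changed_le (hr : IsRankFunction r) {A : Finset α} {e : α} (he : e ∉ A) (i : ℕ) :
    #(changed r A e i) ≤ i := by
  have h1 : #(changed r A e i) + ∑ x ∈ A, load r (insert e A) i x ≤ ∑ x ∈ A, load r A i x := by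
    rw [changed, card_filter, ← sum_add_distrib]
    refine sum_le_sum fun x hx => ?_
    have := load_insert_le hr A e i x hx
    split_ifs <;> omega
  have h2 := sum_load hr (insert e A) i
  rw [sum_insert he] at h2
  rw [sum_load hr A i] at h1
  have h3 := load_le r (insert e A) i e
  have h4 : i * r A ≤ i * r (insert e A) := Nat.mul_le_mul_left _ (hr.le_insert _ _)
  omega

/-- After the insertion of `e`, every element of a base of the packing is `e` itself, or belongs to
the corresponding old base, or has changed its load before. -/
lemma greedyBase_insert_subset (hr : IsRankFunction r) (A : Finset α) (e : α) (i : ℕ) :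
    greedyBase r (loadKey (load r (insert e A) i)) (insert e A) ⊆
      insert e (greedyBase r (loadKey (load r A i)) A ∪ changed r A e i) := by
  intro x hx
  rcases mem_insert.1 (greedyBase_subset _ _ _ hx) with rfl | hxA
  · exact mem_insert_self _ _
  refine mem_insert_of_mem (mem_union.2 ?_)
  by_cases h : load r (insert e A) i x = load r A i x
  · exact Or.inl (mem_greedyBase_of_load_eq hr hxA (load_insert_le hr A e i) h hx)
  · exact Or.inr (mem_filter.2 ⟨hxA, h⟩)

lemma card_insert_guess_le (hr : IsRankFunction r) {A : Finset α} {e : α} (he : e ∉ A) (i : ℕ) :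
    #(insert e (greedyBase r (loadKey (load r A i)) A ∪ changed r A e i)) ≤
      r (insert e A) + (i + 1) := by
  have h1 := card_insert_le e (greedyBase r (loadKey (load r A i)) A ∪ changed r A e i)
  have h2 := card_union_le (greedyBase r (loadKey (load r A i)) A) (changed r A e i)
  rw [card_greedyBase hr (loadKey_injective _)] at h2
  have h3 := card_changed_le hr he i
  have h4 := hr.le_insert A e
  omega

/-- The counterpart of `greedyBase_insert_subset` for a deletion of `e`. -/
lemma sdiff_subset_greedyBase (hr : IsRankFunction r) (A : Finset α) (e : α) (i : ℕ) :
    greedyBase r (loadKey (load r (insert e A) i)) (insert e A) \ insert e (changed r A e i) ⊆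
      greedyBase r (loadKey (load r A i)) A := by
  intro x hx
  have h := greedyBase_insert_subset hr A e i (mem_sdiff.1 hx).1
  have h' := (mem_sdiff.1 hx).2
  simp only [mem_insert, mem_union] at h h'
  tauto

lemma rank_le_card_sdiff_guess (hr : IsRankFunction r) {A : Finset α} {e : α} (he : e ∉ A)
    (i : ℕ) :
    r A ≤ #(greedyBase r (loadKey (load r (insert e A) i)) (insert e A) \
      insert e (changed r A e i)) + (i + 1) := by
  have h1 := le_card_sdiff (insert e (changed r A e i))
    (greedyBase r (loadKey (load r (insert e A) i)) (insert e A))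
  rw [card_greedyBase hr (loadKey_injective _)] at h1
  have h2 := card_insert_le e (changed r A e i)
  have h3 := card_changed_le hr he i
  have h4 := hr.le_insert A e
  omega

end Load

/-! ### The covering number and the least load -/

section Estimate

variable {α : Type u} [LinearOrder α] {r : Finset α → ℕ}

/-- The estimate of the covering number of `A` given by loads `l` of `k` bases: `k` divided by the
least load of an element of `A`. -/
noncomputable def loadEstimate (k : ℕ) (l : α → ℕ) (A : Finset α) : ℝ≥0∞ :=
  ⨆ x ∈ A, (k : ℝ≥0∞) / (l x : ℝ≥0∞)

/-- The bases of any packing meet `X` in at most `r X` elements each, so some element of `X` has at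
most the average load. -/
lemma div_le_loadEstimate (hr : IsRankFunction r) {k : ℕ} (hk : 0 < k) {A X : Finset α}
    (hX : X ⊆ A) (hne : X.Nonempty) :
    (#X : ℝ≥0∞) / (r X : ℝ≥0∞) ≤ loadEstimate k (load r A k) A := by
  obtain ⟨x, hx, hmin⟩ := exists_min_image X (load r A k) hne
  refine le_trans ?_ (le_iSup₂ (f := fun x _ => (k : ℝ≥0∞) / (load r A k x : ℝ≥0∞)) x (hX hx))
  have hsum : #X * load r A k x ≤ k * r X :=
    (card_nsmul_le_sum X _ _ hmin).trans (sum_load_le hr hX k)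
  rcases Nat.eq_zero_or_pos (load r A k x) with h0 | hpos
  · rw [h0, Nat.cast_zero, ENNReal.div_zero (by exact_mod_cast hk.ne')]
    exact le_top
  have hrX : 0 < r X := by
    by_contra h
    have : r X = 0 := by omega
    rw [this, mul_zero] at hsum
    have := Nat.mul_pos hne.card_pos hpos
    omega
  rw [ENNReal.div_le_iff (by exact_mod_cast hrX.ne') (by simp), ← ENNReal.mul_div_right_comm,
    ENNReal.le_div_iff_mul_le (by simp [hpos.ne']) (by simp)]
  exact_mod_cast hsum

/-- The potential `∑ exp (-η · load)` shrinks by a constant factor with every base. -/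
lemma sum_exp_neg_load_le (hr : IsRankFunction r) {A : Finset α} {b η : ℝ} (hη : 0 ≤ η)
    (hb0 : 0 < b) (hb : ∀ X ⊆ A, (#X : ℝ) ≤ b * r X) (k : ℕ) :
    ∑ x ∈ A, Real.exp (-η * load r A k x) ≤ #A * Real.exp (-(1 - Real.exp (-η)) * k / b) := by
  induction k with
  | zero => simp [load]
  | succ k ih =>
    have hstep : ∑ x ∈ A, Real.exp (-η * load r A (k + 1) x) =
        ∑ x ∈ A, Real.exp (-η * load r A k x) - (1 - Real.exp (-η)) *
          ∑ x ∈ greedyBase r (loadKey (load r A k)) A, Real.exp (-η * load r A k x) := by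
      rw [mul_sum, eq_sub_iff_add_eq,
        ← inter_eq_right.2 (greedyBase_subset r (loadKey (load r A k)) A),
        ← filter_mem_eq_inter, sum_filter, ← sum_add_distrib]
      refine sum_congr rfl fun x hx => ?_
      rw [load_succ]
      split_ifs with h
      · push_cast
        rw [mul_add, Real.exp_add, mul_one]
        ring
      · simp
    have havg := sum_le_mul_sum_greedyBase hr (loadKey_injective (load r A k))
      (w := fun x => Real.exp (-η * load r A k x)) (A := A) (b := b) (fun x y hxy => by
        have : load r A k x ≤ load r A k y := by
          rcases hxy.lt_or_eq with h | h
          · rcases loadKey_lt_iff.1 h with h | h <;> omega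
          · exact (congrArg _ (loadKey_injective _ h)).le
        have h' : (load r A k x : ℝ) ≤ load r A k y := by exact_mod_cast this
        exact Real.exp_le_exp.2 (by nlinarith)) (fun x => (Real.exp_pos _).le) hb
    set Φ := ∑ x ∈ A, Real.exp (-η * load r A k x)
    set W := ∑ x ∈ greedyBase r (loadKey (load r A k)) A, Real.exp (-η * load r A k x)
    have hq : 0 ≤ 1 - Real.exp (-η) := by
      have := Real.exp_le_one_iff.2 (by linarith : -η ≤ 0)
      linarith
    have hW : Φ / b ≤ W := by rw [div_le_iff₀ hb0]; linarith
    have hΦ : 0 ≤ Φ := sum_nonneg fun x _ => (Real.exp_pos _).le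
    rw [hstep]
    calc Φ - (1 - Real.exp (-η)) * W ≤ Φ * (-(1 - Real.exp (-η)) / b + 1) := by
          have := mul_le_mul_of_nonneg_left hW hq
          have h2 : Φ * (-(1 - Real.exp (-η)) / b + 1) = Φ - (1 - Real.exp (-η)) * (Φ / b) := by
            field_simp
            ring
          linarith
      _ ≤ Φ * Real.exp (-(1 - Real.exp (-η)) / b) :=
          mul_le_mul_of_nonneg_left (Real.add_one_le_exp _) hΦ
      _ ≤ #A * Real.exp (-(1 - Real.exp (-η)) * k / b) * Real.exp (-(1 - Real.exp (-η)) / b) :=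
          mul_le_mul_of_nonneg_right ih (Real.exp_pos _).le
      _ = #A * Real.exp (-(1 - Real.exp (-η)) * ((k + 1 : ℕ) : ℝ) / b) := by
          rw [mul_assoc, ← Real.exp_add]
          congr 2
          push_cast
          ring

/-- A greedy packing of sufficiently many bases covers every element almost as often as an optimal
fractional one. -/
lemma loadEstimate_le (hr : IsRankFunction r) {A : Finset α} {b δ : ℝ} {n k : ℕ} (hδ : 0 < δ)
    (hδ1 : δ ≤ 1) (hb0 : 0 < b) (hb : ∀ X ⊆ A, (#X : ℝ) ≤ b * r X) (hA : #A ≤ n)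
    (hk0 : 0 < k) (hk : 16 * b * Real.log n / δ ^ 2 ≤ k) :
    loadEstimate k (load r A k) A ≤ ENNReal.ofReal ((1 + δ) * b) := by
  refine iSup₂_le fun x hx => ?_
  have hn : (0 : ℝ) < n := by exact_mod_cast (card_pos.2 ⟨x, hx⟩).trans_le hA
  have hη : 0 ≤ δ / 4 := by positivity
  have h1 : Real.exp (-(δ / 4) * load r A k x) ≤
      n * Real.exp (-(1 - Real.exp (-(δ / 4))) * k / b) :=
    (single_le_sum (f := fun x => Real.exp (-(δ / 4) * load r A k x))
      (fun y _ => (Real.exp_pos _).le) hx).trans ((sum_exp_neg_load_le hr hη hb0 hb k).trans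
        (mul_le_mul_of_nonneg_right (by exact_mod_cast hA) (Real.exp_pos _).le))
  have h2 : -(δ / 4) * load r A k x ≤ Real.log n + -(1 - Real.exp (-(δ / 4))) * k / b := by
    rw [← Real.exp_le_exp, Real.exp_add, Real.exp_log hn]
    exact h1
  have h3 : Real.exp (-(δ / 4)) ≤ 1 - δ / 4 + (δ / 4) ^ 2 := by
    have := (abs_le.1 (Real.abs_exp_sub_one_sub_id_le (x := -(δ / 4))
      (by rw [abs_neg, abs_of_nonneg hη]; linarith))).2
    nlinarith
  have hkR : (0 : ℝ) < k := by exact_mod_cast hk0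
  have hkb : 0 < k / b := div_pos hkR hb0
  have h4 : Real.log n ≤ δ ^ 2 / 16 * (k / b) := by
    rw [div_le_iff₀ (by positivity)] at hk
    rw [mul_div_assoc', le_div_iff₀ hb0]
    linarith
  have h5 : (1 - δ / 2) * (k / b) ≤ load r A k x := by
    have e1 : -(1 - Real.exp (-(δ / 4))) * k / b = -(1 - Real.exp (-(δ / 4))) * (k / b) := by ring
    rw [e1] at h2
    have h6 : (δ / 4 - (δ / 4) ^ 2) * (k / b) ≤ (1 - Real.exp (-(δ / 4))) * (k / b) :=
      mul_le_mul_of_nonneg_right (by linarith) hkb.le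
    have h7 : δ / 4 * ((1 - δ / 2) * (k / b)) ≤ δ / 4 * load r A k x := by nlinarith
    exact le_of_mul_le_mul_left h7 (by positivity)
  have hlpos : (0 : ℝ) < load r A k x := lt_of_lt_of_le (mul_pos (by linarith) hkb) h5
  have h6 : (k : ℝ) / load r A k x ≤ (1 + δ) * b := by
    rw [div_le_iff₀ hlpos]
    have h8 : (1 + δ) * b * ((1 - δ / 2) * (k / b)) ≤ (1 + δ) * b * load r A k x :=
      mul_le_mul_of_nonneg_left h5 (by positivity)
    have h9 : (1 + δ) * b * ((1 - δ / 2) * (k / b)) = (1 + δ) * (1 - δ / 2) * k := by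
      field_simp
    have h10 : 1 ≤ (1 + δ) * (1 - δ / 2) := by nlinarith
    nlinarith
  rw [← ENNReal.ofReal_natCast, ← ENNReal.ofReal_natCast, ← ENNReal.ofReal_div_of_pos hlpos]
  exact ENNReal.ofReal_le_ofReal h6

end Estimate

/-! ### Rank programs -/

namespace RankProgram

variable {α : Type u} {β : Type v}

/-- Sequential composition: run the first program and continue depending on its result. -/
def bind {γ : Type*} : RankProgram α β → (β → RankProgram α γ) → RankProgram α γ
  | ret b, f => f b
  | query A next, f => query A fun q => (next q).bind f

@[simp] lemma result_bind {γ : Type*} (M : Matroid α) (p : RankProgram α β)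
    (f : β → RankProgram α γ) : (p.bind f).result M = (f (p.result M)).result M := by
  induction p with
  | ret b => rfl
  | query A next ih => exact ih _

@[simp] lemma numQueries_bind {γ : Type*} (M : Matroid α) (p : RankProgram α β)
    (f : β → RankProgram α γ) :
    (p.bind f).numQueries M = p.numQueries M + (f (p.result M)).numQueries M := by
  induction p with
  | ret b => simp [bind, numQueries, result]
  | query A next ih =>
    simp only [bind, numQueries, result, ih]
    omega

@[simp] lemma result_ret (M : Matroid α) (b : β) : (ret b : RankProgram α β).result M = b := rfl

@[simp] lemma numQueries_ret (M : Matroid α) (b : β) :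
    (ret b : RankProgram α β).numQueries M = 0 := rfl

@[simp] lemma result_query (M : Matroid α) (A : Set α) (next : ℕ → RankProgram α β) :
    (query A next).result M = (next (M.eRk A).toNat).result M := rfl

@[simp] lemma numQueries_query (M : Matroid α) (A : Set α) (next : ℕ → RankProgram α β) :
    (query A next).numQueries M = (next (M.eRk A).toNat).numQueries M + 1 := rfl

/-- Run the programs `f 0, …, f (J - 1)` one after the other and collect their results. -/
def sequence [Inhabited β] (f : ℕ → RankProgram α β) : ℕ → RankProgram α (ℕ → β)
  | 0 => ret fun _ => default
  | J + 1 => (sequence f J).bind fun L => (f J).bind fun b => ret (Function.update L J b)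

lemma result_sequence [Inhabited β] (M : Matroid α) (f : ℕ → RankProgram α β) (J : ℕ) :
    (sequence f J).result M = fun j => if j < J then (f j).result M else default := by
  induction J with
  | zero => rfl
  | succ J ih =>
    funext j
    simp only [sequence, result_bind, result_ret, ih, Function.update_apply]
    rcases lt_trichotomy j J with h | rfl | h
    · simp [h, h.ne, h.trans (Nat.lt_succ_self J)]
    · simp
    · simp [h.ne', show ¬ j < J by omega, show ¬ j < J + 1 by omega]

lemma numQueries_sequence_le [Inhabited β] (M : Matroid α) (f : ℕ → RankProgram α β) {J q : ℕ}
    (h : ∀ j < J, (f j).numQueries M ≤ q) : (sequence f J).numQueries M ≤ J * q := by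
  induction J with
  | zero => simp [sequence]
  | succ J ih =>
    simp only [sequence, numQueries_bind, numQueries_ret, add_zero]
    have h1 := ih fun j hj => h j (hj.trans (Nat.lt_succ_self J))
    have h2 := h J (Nat.lt_succ_self J)
    rw [Nat.succ_mul]
    omega

/-- Ask for the ranks of all sets in a list. -/
noncomputable def learn [DecidableEq α] : List (Finset α) → RankProgram α (Finset α → ℕ)
  | [] => ret fun _ => 0
  | X :: l => query X fun q => (learn l).bind fun g => ret (Function.update g X q)

end RankProgram

/-- The rank of a finite set. -/
noncomputable def finRank {α : Type u} (M : Matroid α) (X : Finset α) : ℕ :=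
  (M.eRk (X : Set α)).toNat

lemma coe_finRank {α : Type u} (M : Matroid α) (X : Finset α) :
    (finRank M X : ℕ∞) = M.eRk (X : Set α) := by
  refine ENat.natCast_toNat (ne_top_of_le_ne_top ?_ (M.eRk_le_encard X))
  rw [Set.encard_coe_eq_coe_finsetCard]
  exact ENat.natCast_ne_top _

lemma isRankFunction_finRank {α : Type u} [DecidableEq α] (M : Matroid α) :
    IsRankFunction (finRank M) where
  empty := by simp [finRank]
  le_insert X x := by
    rw [← Nat.cast_le (α := ℕ∞), coe_finRank, coe_finRank]
    exact M.eRk_mono (by simp)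
  insert_le X x := by
    rw [← Nat.cast_le (α := ℕ∞)]
    push_cast
    rw [coe_finRank, coe_finRank, coe_insert]
    exact M.eRk_insert_le_add_one x X
  insert_eq_of_subset X Y x hXY h := by
    by_cases hx : x ∈ Y
    · rw [insert_eq_of_mem hx]
    have h1 := M.eRk_inter_add_eRk_union_le (insert x X : Finset α) (Y : Set α)
    have e1 : ((insert x X : Finset α) : Set α) ∩ Y = X := by
      rw [coe_insert, Set.insert_inter_of_notMem (by exact_mod_cast hx),
        Set.inter_eq_left.2 (by exact_mod_cast hXY)]
    have e2 : ((insert x X : Finset α) : Set α) ∪ Y = (insert x Y : Finset α) := by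
      rw [coe_insert, coe_insert, Set.insert_union, Set.union_eq_right.2 (by exact_mod_cast hXY)]
    rw [e1, e2, ← coe_finRank, ← coe_finRank, ← coe_finRank, ← coe_finRank, h] at h1
    have h2 : finRank M X + finRank M (insert x Y) ≤ finRank M X + finRank M Y := by
      exact_mod_cast h1
    have h3 : finRank M Y ≤ finRank M (insert x Y) := by
      rw [← Nat.cast_le (α := ℕ∞), coe_finRank, coe_finRank]
      exact M.eRk_mono (by simp)
    omega

lemma result_learn {α : Type u} [DecidableEq α] (M : Matroid α) {l : List (Finset α)}
    {X : Finset α} (hX : X ∈ l) : (RankProgram.learn l).result M X = finRank M X := by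
  induction l with
  | nil => simp at hX
  | cons Y l ih =>
    simp only [RankProgram.learn, RankProgram.result_query, RankProgram.result_bind,
      RankProgram.result_ret, Function.update_apply]
    split_ifs with h
    · rw [h, finRank]
    · exact ih ((List.mem_cons.1 hX).resolve_left h)

/-! ### Correcting a guess of a greedy base by bisection -/

section Bisection

variable {α : Type u} {κ : Type v} [LinearOrder κ]

/-- The first `j` elements of `A` in the order given by the keys. -/
def initialSegment (k : α → κ) (A : Finset α) (j : ℕ) : Finset α :=
  {x ∈ A | #{y ∈ A | k y < k x} < j}

lemma initialSegment_subset (k : α → κ) (A : Finset α) (j : ℕ) : initialSegment k A j ⊆ A :=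
  filter_subset _ _

lemma initialSegment_mono (k : α → κ) (A : Finset α) {i j : ℕ} (h : i ≤ j) :
    initialSegment k A i ⊆ initialSegment k A j := fun x hx => by
  simp only [initialSegment, mem_filter] at hx ⊢
  exact ⟨hx.1, hx.2.trans_le h⟩

lemma initialSegment_zero (k : α → κ) (A : Finset α) : initialSegment k A 0 = ∅ := by
  simp [initialSegment]

lemma initialSegment_of_card_le (k : α → κ) {A : Finset α} {j : ℕ} (h : #A ≤ j) :
    initialSegment k A j = A := by
  refine filter_true_of_mem fun x hx => (card_lt_card ?_).trans_le h
  refine filter_ssubset.2 ⟨x, hx, lt_irrefl _⟩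

lemma initialSegment_isLower (k : α → κ) (A : Finset α) (j : ℕ) :
    ∀ x ∈ initialSegment k A j, ∀ y ∈ A, k y < k x → y ∈ initialSegment k A j := by
  intro x hx y hy hyx
  simp only [initialSegment, mem_filter] at hx ⊢
  refine ⟨hy, lt_of_le_of_lt (card_le_card fun z hz => ?_) hx.2⟩
  simp only [mem_filter] at hz ⊢
  exact ⟨hz.1, hz.2.trans hyx⟩

variable [DecidableEq α]

lemma card_initialSegment_sdiff_le {k : α → κ} (hk : Function.Injective k) (A : Finset α)
    (j : ℕ) : #(initialSegment k A (j + 1) \ initialSegment k A j) ≤ 1 := by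
  have key : ∀ x ∈ A, ∀ y ∈ A, k x < k y → #{z ∈ A | k z < k x} < #{z ∈ A | k z < k y} := by
    intro x hx y _ hxy
    refine card_lt_card ((ssubset_iff_of_subset fun z hz => ?_).2 ⟨x, ?_, ?_⟩)
    · simp only [mem_filter] at hz ⊢
      exact ⟨hz.1, hz.2.trans hxy⟩
    · simp [hx, hxy]
    · simp
  refine card_le_one.2 fun x hx y hy => ?_
  simp only [initialSegment, mem_sdiff, mem_filter, not_and, not_lt] at hx hy
  have hx2 := hx.2 hx.1.1
  have hy2 := hy.2 hy.1.1
  rcases lt_trichotomy (k x) (k y) with h | h | h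
  · have := key x hx.1.1 y hy.1.1 h; omega
  · exact hk h
  · have := key y hy.1.1 x hx.1.1 h; omega

/-- Finds the elements at the positions `a, …, a + 2 ^ s - 1` at which a guess `G` differs from the
greedy base. `va` and `vb` are the numbers of differences before the first and up to the last of
these positions; on every initial segment this number is the difference between the rank and the
number of elements of `G`, so that the search stops on every interval without a difference. -/
noncomputable def findDiff (k : α → κ) (A G : Finset α) :
    ℕ → ℕ → ℕ → ℕ → RankProgram α (Finset α)
  | 0, a, va, vb => .ret (if va = vb then ∅ else initialSegment k A (a + 1) \ initialSegment k A a)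
  | s + 1, a, va, vb =>
    if va = vb then .ret ∅ else
      .query (initialSegment k A (a + 2 ^ s)) fun q =>
        (findDiff k A G s a va (Nat.dist q #(G ∩ initialSegment k A (a + 2 ^ s)))).bind fun J₁ =>
          (findDiff k A G s (a + 2 ^ s)
            (Nat.dist q #(G ∩ initialSegment k A (a + 2 ^ s))) vb).bind fun J₂ => .ret (J₁ ∪ J₂)

lemma findDiff_spec {k : α → κ} (hk : Function.Injective k) {A G Δ : Finset α} {M : Matroid α}
    (hΔ : ∀ j, Nat.dist (finRank M (initialSegment k A j)) #(G ∩ initialSegment k A j) =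
      #(Δ ∩ initialSegment k A j)) (s : ℕ) :
    ∀ a va vb : ℕ, va = #(Δ ∩ initialSegment k A a) →
      vb = #(Δ ∩ initialSegment k A (a + 2 ^ s)) →
      (findDiff k A G s a va vb).result M =
        Δ ∩ (initialSegment k A (a + 2 ^ s) \ initialSegment k A a) ∧
      (findDiff k A G s a va vb).numQueries M ≤ (vb - va) * s := by
  have hdisj : ∀ P Q : Finset α, Δ ∩ (Q \ P) = ∅ ↔ Δ ∩ Q ⊆ Δ ∩ P := by
    intro P Q
    rw [← inter_sdiff_assoc, sdiff_eq_empty_iff_subset]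
    exact ⟨fun h => subset_inter inter_subset_left h, fun h => h.trans inter_subset_right⟩
  have hempty : ∀ i j : ℕ, i ≤ j → #(Δ ∩ initialSegment k A i) = #(Δ ∩ initialSegment k A j) →
      Δ ∩ (initialSegment k A j \ initialSegment k A i) = ∅ := by
    intro i j hij h
    rw [hdisj]
    exact (eq_of_subset_of_card_le
      (inter_subset_inter Subset.rfl (initialSegment_mono k A hij)) h.ge).ge
  induction s with
  | zero =>
    intro a va vb hva hvb
    simp only [findDiff, RankProgram.result_ret, RankProgram.numQueries_ret, pow_zero] at hvb ⊢
    refine ⟨?_, Nat.zero_le _⟩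
    split_ifs with h
    · exact (hempty a (a + 1) (Nat.le_succ a) (by rw [← hva, ← hvb, h])).symm
    · refine (eq_of_subset_of_card_le inter_subset_right
        ((card_initialSegment_sdiff_le hk A a).trans (Nat.one_le_iff_ne_zero.2 fun h0 => ?_))).symm
      rw [card_eq_zero, hdisj] at h0
      exact h (hva.trans ((le_antisymm (card_le_card (inter_subset_inter Subset.rfl
        (initialSegment_mono k A (Nat.le_succ a)))) (card_le_card h0)).trans hvb.symm))
  | succ s ih =>
    intro a va vb hva hvb
    have hle1 : a ≤ a + 2 ^ s := Nat.le_add_right _ _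
    have hadd : a + 2 ^ (s + 1) = a + 2 ^ s + 2 ^ s := by ring
    have hle2 : a + 2 ^ s ≤ a + 2 ^ (s + 1) := by omega
    rw [findDiff]
    split_ifs with h
    · refine ⟨?_, by simp⟩
      exact (hempty _ _ (hle1.trans hle2) (by rw [← hva, ← hvb, h])).symm
    · have hv := hΔ (a + 2 ^ s)
      rw [finRank] at hv
      obtain ⟨r1, q1⟩ := ih a va _ hva hv
      obtain ⟨r2, q2⟩ := ih (a + 2 ^ s) _ vb hv (hvb.trans (by rw [hadd]))
      simp only [RankProgram.result_query, RankProgram.numQueries_query, RankProgram.result_bind,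
        RankProgram.numQueries_bind, RankProgram.result_ret, RankProgram.numQueries_ret]
      rw [hv] at r1 r2 q1 q2 ⊢
      have m1 : va ≤ #(Δ ∩ initialSegment k A (a + 2 ^ s)) :=
        hva.trans_le (card_le_card (inter_subset_inter Subset.rfl (initialSegment_mono k A hle1)))
      have m2 : #(Δ ∩ initialSegment k A (a + 2 ^ s)) ≤ vb :=
        (card_le_card (inter_subset_inter Subset.rfl (initialSegment_mono k A hle2))).trans_eq hvb.symm
      refine ⟨?_, ?_⟩
      · rw [r1, r2, ← hadd, ← inter_union_distrib_left]
        congr 1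
        ext x
        have s1 := @initialSegment_mono _ _ _ k A _ _ hle1 x
        have s2 := @initialSegment_mono _ _ _ k A _ _ hle2 x
        simp only [mem_union, mem_sdiff]
        tauto
      · set v := #(Δ ∩ initialSegment k A (a + 2 ^ s))
        have e : (vb - va) * (s + 1) = (v - va) * s + (vb - v) * s + (vb - va) := by
          rw [← Nat.add_mul, show v - va + (vb - v) = vb - va by omega]
          ring
        have : 1 ≤ vb - va := by omega
        omega

/-- Computes the greedy base from a guess `G` that is contained in it or contains it. -/
noncomputable def correctBase (k : α → κ) (A G : Finset α) (s : ℕ) : RankProgram α (Finset α) :=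
  .query (initialSegment k A (2 ^ s)) fun q =>
    (findDiff k A G s 0 0 (Nat.dist q #(G ∩ initialSegment k A (2 ^ s)))).bind fun J =>
      .ret (symmDiff G J)

lemma dist_card_inter {B G P : Finset α} (h : G ⊆ B ∨ B ⊆ G) :
    Nat.dist #(B ∩ P) #(G ∩ P) = #(symmDiff G B ∩ P) := by
  rcases h with h | h
  · have e : symmDiff G B ∩ P = (B ∩ P) \ (G ∩ P) := by
      ext x
      have := @h x
      simp only [mem_inter, mem_symmDiff, mem_sdiff]
      tauto
    have hs : G ∩ P ⊆ B ∩ P := inter_subset_inter_right h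
    rw [e, card_sdiff_of_subset hs, Nat.dist_eq_sub_of_le_right (card_le_card hs)]
  · have e : symmDiff G B ∩ P = (G ∩ P) \ (B ∩ P) := by
      ext x
      have := @h x
      simp only [mem_inter, mem_symmDiff, mem_sdiff]
      tauto
    have hs : B ∩ P ⊆ G ∩ P := inter_subset_inter_right h
    rw [e, card_sdiff_of_subset hs, Nat.dist_eq_sub_of_le (card_le_card hs)]

lemma correctBase_spec {k : α → κ} (hk : Function.Injective k) {A G : Finset α} {M : Matroid α}
    {s d : ℕ} (hA : #A ≤ 2 ^ s) (hG : G ⊆ A)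
    (h : G ⊆ greedyBase (finRank M) k A ∨ greedyBase (finRank M) k A ⊆ G)
    (hd : #(symmDiff G (greedyBase (finRank M) k A)) ≤ d) :
    (correctBase k A G s).result M = greedyBase (finRank M) k A ∧
      (correctBase k A G s).numQueries M ≤ 1 + d * s := by
  have hr := isRankFunction_finRank M
  set B := greedyBase (finRank M) k A with hB
  have hΔ : ∀ j, Nat.dist (finRank M (initialSegment k A j)) #(G ∩ initialSegment k A j) =
      #(symmDiff G B ∩ initialSegment k A j) := by
    intro j
    rw [← card_greedyBase hr hk (initialSegment k A j), ← greedyBase_inter_of_isLower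
      (initialSegment_subset k A j) (initialSegment_isLower k A j)]
    exact dist_card_inter h
  have hv := hΔ (2 ^ s)
  rw [finRank] at hv
  obtain ⟨h1, h2⟩ := findDiff_spec hk hΔ s 0 0 _ (by simp [initialSegment_zero])
    (hv.trans (by rw [zero_add]))
  have hsub : symmDiff G B ⊆ A := fun x hx => by
    rcases mem_symmDiff.1 hx with hx | hx
    · exact hG hx.1
    · exact greedyBase_subset _ _ _ hx.1
  simp only [correctBase, RankProgram.result_query, RankProgram.numQueries_query,
    RankProgram.result_bind, RankProgram.numQueries_bind, RankProgram.result_ret,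
    RankProgram.numQueries_ret]
  refine ⟨?_, ?_⟩
  · rw [h1, zero_add, initialSegment_zero, sdiff_empty, initialSegment_of_card_le k hA,
      inter_eq_left.2 hsub, symmDiff_symmDiff_cancel_left]
  · have h3 : (#(symmDiff G B ∩ initialSegment k A (2 ^ s)) - 0) * s ≤ d * s :=
      Nat.mul_le_mul_right _ ((Nat.sub_le _ _).trans ((card_le_card inter_subset_left).trans hd))
    rw [hv] at h2 ⊢
    omega

end Bisection

/-! ### Updating the loads of a packing -/

section Rebuild

variable {α : Type u} [LinearOrder α]

/-- Computes the loads of the greedy packing of `A` up to a given number of bases; `guess i l` is a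
guess of the base following the first `i` ones, whose loads are `l`. -/
noncomputable def rebuild (A : Finset α) (guess : ℕ → (α → ℕ) → Finset α) (s : ℕ) :
    ℕ → RankProgram α (ℕ → α → ℕ)
  | 0 => .ret fun _ _ => 0
  | i + 1 => (rebuild A guess s i).bind fun L =>
      (correctBase (loadKey (L i)) A (guess i (L i)) s).bind fun B =>
        .ret fun m x => if m ≤ i then L m x else L i x + if x ∈ B then 1 else 0

lemma rebuild_spec {A : Finset α} {guess : ℕ → (α → ℕ) → Finset α} {s : ℕ} {M : Matroid α}
    (hA : #A ≤ 2 ^ s) (k : ℕ)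
    (hG : ∀ i < k, guess i (load (finRank M) A i) ⊆ A)
    (h : ∀ i < k, guess i (load (finRank M) A i) ⊆
        greedyBase (finRank M) (loadKey (load (finRank M) A i)) A ∨
      greedyBase (finRank M) (loadKey (load (finRank M) A i)) A ⊆
        guess i (load (finRank M) A i))
    (hd : ∀ i < k, #(symmDiff (guess i (load (finRank M) A i))
      (greedyBase (finRank M) (loadKey (load (finRank M) A i)) A)) ≤ i + 1) :
    (rebuild A guess s k).result M = (fun m => load (finRank M) A (min m k)) ∧
      (rebuild A guess s k).numQueries M ≤ k + k * k * s := by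
  induction k with
  | zero =>
    refine ⟨?_, by simp [rebuild]⟩
    funext m
    simp [rebuild, load]
  | succ k ih =>
    obtain ⟨h1, h2⟩ := ih (fun i hi => hG i (hi.trans (Nat.lt_succ_self k)))
      (fun i hi => h i (hi.trans (Nat.lt_succ_self k)))
      (fun i hi => hd i (hi.trans (Nat.lt_succ_self k)))
    obtain ⟨h3, h4⟩ := correctBase_spec (M := M) (loadKey_injective (load (finRank M) A k)) hA
      (hG k (Nat.lt_succ_self k)) (h k (Nat.lt_succ_self k)) (hd k (Nat.lt_succ_self k))
    simp only [rebuild, RankProgram.result_bind, RankProgram.numQueries_bind,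
      RankProgram.result_ret, RankProgram.numQueries_ret, h1, min_self, h3]
    refine ⟨?_, ?_⟩
    · funext m x
      split_ifs with hm hx
      · rw [min_eq_left hm, min_eq_left (hm.trans (Nat.le_succ k))]
      · rw [min_eq_right (show k + 1 ≤ m by omega), load_succ, if_pos hx]
      · rw [min_eq_right (show k + 1 ≤ m by omega), load_succ, if_neg hx]
    · have : (k + 1) * (k + 1) * s = k * k * s + (k + 1) * s + k * s := by ring
      have := Nat.zero_le (k * s)
      omega

/-- The elements of `A` whose load is increased by the base with index `i`. -/
def baseOfLoads (A : Finset α) (L : ℕ → α → ℕ) (i : ℕ) : Finset α :=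
  {x ∈ A | L (i + 1) x ≠ L i x}

lemma baseOfLoads_load {r : Finset α → ℕ} {A : Finset α} {i k : ℕ} (hi : i < k) :
    baseOfLoads A (fun m => load r A (min m k)) i = greedyBase r (loadKey (load r A i)) A := by
  ext x
  simp only [baseOfLoads, mem_filter, min_eq_left (Nat.succ_le_of_lt hi), min_eq_left hi.le,
    load_succ]
  have := @greedyBase_subset _ _ _ _ r (loadKey (load r A i)) A x
  split_ifs with h <;> simp_all

/-- The guess of a base of the packing of `insert e A`, given the loads `L` for `A`. -/
def insertGuess (A : Finset α) (e : α) (L : ℕ → α → ℕ) (i : ℕ) (l : α → ℕ) : Finset α :=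
  insert e (baseOfLoads A L i ∪ {x ∈ A | l x ≠ L i x})

/-- The guess of a base of the packing of `A`, given the loads `L` for `insert e A`. -/
def deleteGuess (A : Finset α) (e : α) (L : ℕ → α → ℕ) (i : ℕ) (l : α → ℕ) : Finset α :=
  baseOfLoads (insert e A) L i \ insert e {x ∈ A | L i x ≠ l x}

lemma rebuild_insertGuess_spec {A : Finset α} {e : α} (he : e ∉ A) {s : ℕ} {M : Matroid α}
    (hA : #(insert e A) ≤ 2 ^ s) (k : ℕ) {L : ℕ → α → ℕ}
    (hL : L = fun m => load (finRank M) A (min m k)) :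
    (rebuild (insert e A) (insertGuess A e L) s k).result M =
        (fun m => load (finRank M) (insert e A) (min m k)) ∧
      (rebuild (insert e A) (insertGuess A e L) s k).numQueries M ≤ k + k * k * s := by
  have hr := isRankFunction_finRank M
  have hguess : ∀ i < k, insertGuess A e L i (load (finRank M) (insert e A) i) =
      insert e (greedyBase (finRank M) (loadKey (load (finRank M) A i)) A ∪
        changed (finRank M) A e i) := by
    intro i hi
    simp only [insertGuess, hL, baseOfLoads_load hi, changed, min_eq_left hi.le]
  refine rebuild_spec hA k (fun i hi => ?_) (fun i hi => Or.inr ?_) (fun i hi => ?_) <;>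
    rw [hguess i hi]
  · exact insert_subset_insert _ (union_subset (greedyBase_subset _ _ _) (filter_subset _ _))
  · exact greedyBase_insert_subset hr A e i
  · have hsub := greedyBase_insert_subset hr A e i
    rw [symmDiff_comm, symmDiff_of_le hsub, card_sdiff_of_subset hsub,
      card_greedyBase hr (loadKey_injective _)]
    have := card_insert_guess_le hr he i
    omega

lemma rebuild_deleteGuess_spec {A : Finset α} {e : α} (he : e ∉ A) {s : ℕ} {M : Matroid α}
    {r : Finset α → ℕ} (hr : IsRankFunction r) (hrM : ∀ X ⊆ A, r X = finRank M X)
    (hA : #A ≤ 2 ^ s) (k : ℕ) {L : ℕ → α → ℕ}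
    (hL : L = fun m => load r (insert e A) (min m k)) :
    (rebuild A (deleteGuess A e L) s k).result M = (fun m => load (finRank M) A (min m k)) ∧
      (rebuild A (deleteGuess A e L) s k).numQueries M ≤ k + k * k * s := by
  have hguess : ∀ i < k, deleteGuess A e L i (load (finRank M) A i) =
      greedyBase r (loadKey (load r (insert e A) i)) (insert e A) \
        insert e (changed r A e i) := by
    intro i hi
    simp only [deleteGuess, hL, baseOfLoads_load hi, changed, min_eq_left hi.le,
      load_congr hrM i]
  have hsub : ∀ i, greedyBase r (loadKey (load r (insert e A) i)) (insert e A) \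
        insert e (changed r A e i) ⊆
      greedyBase (finRank M) (loadKey (load (finRank M) A i)) A := by
    intro i
    rw [← load_congr hrM i, ← greedyBase_congr hrM]
    exact sdiff_subset_greedyBase hr A e i
  refine rebuild_spec hA k (fun i hi => ?_) (fun i hi => Or.inl ?_) (fun i hi => ?_) <;>
    rw [hguess i hi]
  · exact (hsub i).trans (greedyBase_subset _ _ _)
  · exact hsub i
  · rw [symmDiff_of_le (hsub i), card_sdiff_of_subset (hsub i),
      card_greedyBase (isRankFunction_finRank M) (loadKey_injective _), ← hrM A Subset.rfl]
    have := rank_le_card_sdiff_guess hr he i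
    omega

end Rebuild

/-! ### Random sampling of the elements -/

section Sampling

open MeasureTheory ProbabilityTheory

/-- The law of independent uniformly distributed labels in the unit interval, one for every element
of the universe. -/
noncomputable def labelLaw (α : Type u) : Measure (α → unitInterval) :=
  Measure.infinitePi fun _ => volume

instance (α : Type u) : IsProbabilityMeasure (labelLaw α) := by
  unfold labelLaw
  infer_instance

/-- The elements of `F` with label at most `p`. -/
noncomputable def sample {α : Type u} (ω : α → unitInterval) (p : unitInterval) (F : Finset α) :
    Finset α :=
  {x ∈ F | ω x ≤ p}

variable {α : Type u}

lemma sample_subset (ω : α → unitInterval) (p : unitInterval) (F : Finset α) :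
    sample ω p F ⊆ F := filter_subset _ _

lemma mgf_card_sample_le (p : unitInterval) (F : Finset α) (t : ℝ) :
    mgf (fun ω => (#(sample ω p F) : ℝ)) (labelLaw α) t ≤
      Real.exp (p * #F * (Real.exp t - 1)) := by
  set g : unitInterval → ℝ := (Set.Iic p).indicator 1 with hg
  have hgm : Measurable g := measurable_one.indicator measurableSet_Iic
  have hind : iIndepFun (fun (x : α) (ω : α → unitInterval) => g (ω x)) (labelLaw α) :=
    iIndepFun_infinitePi fun _ => hgm
  have hsum : (fun ω : α → unitInterval => (#(sample ω p F) : ℝ)) =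
      ∑ x ∈ F, fun ω => g (ω x) := by
    funext ω
    rw [sample, card_filter, Finset.sum_apply]
    push_cast
    refine sum_congr rfl fun x _ => ?_
    simp [hg, Set.indicator_apply]
  have hone : ∀ x : α, mgf (fun ω : α → unitInterval => g (ω x)) (labelLaw α) t =
      1 + p * (Real.exp t - 1) := by
    intro x
    have hmp : MeasurePreserving (Function.eval x) (labelLaw α) (volume : Measure unitInterval) :=
      measurePreserving_eval_infinitePi _ x
    have h1 : mgf (fun ω : α → unitInterval => g (ω x)) (labelLaw α) t = mgf g volume t := by
      rw [mgf, mgf, ← hmp.map_eq, integral_map hmp.measurable.aemeasurable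
        (by fun_prop)]
    have h2 : (fun u => Real.exp (t * g u)) =
        fun u => 1 + (Set.Iic p).indicator (fun _ => Real.exp t - 1) u := by
      funext u
      by_cases hu : u ≤ p <;> simp [hg, hu]
    rw [h1, mgf, h2, integral_add (integrable_const _)
      ((integrable_const _).indicator measurableSet_Iic), integral_const,
      integral_indicator_const _ measurableSet_Iic]
    simp [Measure.real, unitInterval.volume_Iic, ENNReal.toReal_ofReal p.2.1]
  rw [hsum, hind.mgf_sum (fun x => hgm.comp (measurable_pi_apply x)), prod_congr rfl
    fun x _ => hone x, prod_const]
  calc (1 + p * (Real.exp t - 1)) ^ #F ≤ Real.exp (p * (Real.exp t - 1)) ^ #F := by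
        refine pow_le_pow_left₀ ?_ ?_ _
        · have h1 := Real.exp_pos t
          have h2 := p.2.1
          have h3 := p.2.2
          nlinarith
        · rw [add_comm]
          exact Real.add_one_le_exp _
    _ = Real.exp (p * #F * (Real.exp t - 1)) := by
        rw [← Real.exp_nat_mul]
        congr 1
        ring

lemma measurable_card_sample (p : unitInterval) (F : Finset α) :
    Measurable fun ω : α → unitInterval => (#(sample ω p F) : ℝ) := by
  have : (fun ω : α → unitInterval => (#(sample ω p F) : ℝ)) =
      fun ω => ∑ x ∈ F, (Set.Iic p).indicator (1 : unitInterval → ℝ) (ω x) := by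
    funext ω
    rw [sample, card_filter]
    push_cast
    exact sum_congr rfl fun x _ => by simp [Set.indicator_apply]
  rw [this]
  exact Finset.measurable_sum _ fun x _ =>
    (measurable_one.indicator measurableSet_Iic).comp (measurable_pi_apply x)

lemma integrable_exp_mul_card_sample (p : unitInterval) (F : Finset α) (t : ℝ) :
    Integrable (fun ω : α → unitInterval => Real.exp (t * (#(sample ω p F) : ℝ)))
      (labelLaw α) := by
  refine Integrable.of_bound
    ((measurable_card_sample p F).const_mul t).exp.aestronglyMeasurable
    (Real.exp (|t| * #F)) (Filter.Eventually.of_forall fun ω => ?_)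
  rw [Real.norm_eq_abs, abs_of_pos (Real.exp_pos _), Real.exp_le_exp]
  have h1 : (#(sample ω p F) : ℝ) ≤ #F := by exact_mod_cast card_le_card (sample_subset ω p F)
  exact mul_le_mul (le_abs_self t) h1 (Nat.cast_nonneg _) (abs_nonneg t)

/-- Chernoff bound for the upper tail. -/
lemma measure_card_sample_ge_le (p : unitInterval) (F : Finset α) {δ m : ℝ} (hδ : 0 < δ)
    (hδ1 : δ ≤ 1) (hm : (p : ℝ) * #F ≤ m) :
    labelLaw α {ω | (1 + δ) * m ≤ #(sample ω p F)} ≤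
      ENNReal.ofReal (Real.exp (-(δ ^ 2 * m / 4))) := by
  have h := measure_ge_le_exp_mul_mgf (μ := labelLaw α) ((1 + δ) * m)
    (by positivity : 0 ≤ δ / 2) (integrable_exp_mul_card_sample p F (δ / 2))
  rw [← ofReal_measureReal (measure_ne_top _ _)]
  refine ENNReal.ofReal_le_ofReal (h.trans ?_)
  refine (mul_le_mul_of_nonneg_left (mgf_card_sample_le p F (δ / 2)) (Real.exp_pos _).le).trans ?_
  rw [← Real.exp_add, Real.exp_le_exp]
  have h1 : Real.exp (δ / 2) - 1 ≤ δ / 2 + (δ / 2) ^ 2 := by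
    have := (abs_le.1 (Real.abs_exp_sub_one_sub_id_le (x := δ / 2)
      (by rw [abs_of_nonneg (by positivity)]; linarith))).2
    linarith
  have h0 : 0 ≤ (p : ℝ) * #F := mul_nonneg p.2.1 (Nat.cast_nonneg _)
  have h2 : (p : ℝ) * #F * (Real.exp (δ / 2) - 1) ≤ m * (δ / 2 + (δ / 2) ^ 2) :=
    (mul_le_mul_of_nonneg_left h1 h0).trans (mul_le_mul_of_nonneg_right hm (by positivity))
  nlinarith

/-- Chernoff bound for the lower tail. -/
lemma measure_card_sample_le_le (p : unitInterval) (F : Finset α) {δ : ℝ} (hδ : 0 < δ)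
    (hδ1 : δ ≤ 1) :
    labelLaw α {ω | (#(sample ω p F) : ℝ) ≤ (1 - δ) * (p * #F)} ≤
      ENNReal.ofReal (Real.exp (-(δ ^ 2 * (p * #F) / 4))) := by
  have h := measure_le_le_exp_mul_mgf (μ := labelLaw α) ((1 - δ) * (p * #F))
    (by linarith : -(δ / 2) ≤ 0) (integrable_exp_mul_card_sample p F (-(δ / 2)))
  rw [← ofReal_measureReal (measure_ne_top _ _)]
  refine ENNReal.ofReal_le_ofReal (h.trans ?_)
  refine (mul_le_mul_of_nonneg_left (mgf_card_sample_le p F (-(δ / 2)))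
    (Real.exp_pos _).le).trans ?_
  rw [← Real.exp_add, Real.exp_le_exp]
  have h1 : Real.exp (-(δ / 2)) - 1 ≤ -(δ / 2) + (δ / 2) ^ 2 := by
    have := (abs_le.1 (Real.abs_exp_sub_one_sub_id_le (x := -(δ / 2))
      (by rw [abs_neg, abs_of_nonneg (by positivity)]; linarith))).2
    linarith
  have h0 : 0 ≤ (p : ℝ) * #F := mul_nonneg p.2.1 (Nat.cast_nonneg _)
  have h2 := mul_le_mul_of_nonneg_left h1 h0
  nlinarith

end Sampling

/-! ### Sampling preserves large covering numbers -/

section Good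

open MeasureTheory

variable {α : Type u} [LinearOrder α] {r : Finset α → ℕ}

/-- The sample of `E` at rate `p` is good for a matroid of covering number `b`, attained by the set
`A`: no sampled set is denser than `(1 + δ) max (p b) K`, and, if `p b` is at least `K`, then `A`
keeps almost the expected number of elements. -/
def IsGoodSample (r : Finset α → ℕ) (E A : Finset α) (b K δ : ℝ) (p : unitInterval)
    (ω : α → unitInterval) : Prop :=
  (∀ X ⊆ sample ω p E, (#X : ℝ) ≤ (1 + δ) * max (p * b) K * r X) ∧
    (K ≤ p * b → (1 - δ) * (p * #A) ≤ #(sample ω p A))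

/-- The flats of rank `i` are spanned by sets of `i` elements, so there are few of them compared
with the probability `exp (-δ² K i / 4)` that a given one is sampled too densely. -/
lemma measure_not_isGoodSample_le (hr : IsRankFunction r) {E A : Finset α} {b K δ : ℝ} {n : ℕ}
    (p : unitInterval) (hδ : 0 < δ) (hδ1 : δ ≤ 1) (hK : 0 < K)
    (hb : ∀ X ⊆ E, (#X : ℝ) ≤ b * r X) (hA : b ≤ #A) (hE : #E ≤ n)
    (hn : 1 ≤ n) (hq : n * Real.exp (-(δ ^ 2 * K / 4)) ≤ 1) :
    labelLaw α {ω | ¬ IsGoodSample r E A b K δ p ω} ≤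
      ENNReal.ofReal (3 * (n * Real.exp (-(δ ^ 2 * K / 4)))) := by
  set q := Real.exp (-(δ ^ 2 * K / 4)) with hqdef
  have hq0 : 0 < q := Real.exp_pos _
  set m := max (p * b) K with hm
  have hmK : K ≤ m := le_max_right _ _
  set 𝓨 : Finset (Finset α) := {Y ∈ E.powerset | Y.Nonempty ∧ r Y = #Y} with h𝓨
  set cl : Finset α → Finset α := fun Y => {x ∈ E | r (insert x Y) = r Y} with hcl
  -- A set that is too dense is contained in the flat `cl Y` spanned by a base `Y` of it.
  have hcover : {ω | ¬ IsGoodSample r E A b K δ p ω} ⊆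
      (⋃ Y ∈ 𝓨, {ω | (1 + δ) * (m * #Y) ≤ #(sample ω p (cl Y))}) ∪
        (if K ≤ p * b then {ω | (#(sample ω p A) : ℝ) ≤ (1 - δ) * (p * #A)} else ∅) := by
    intro ω hω
    simp only [Set.mem_ofPred_eq, IsGoodSample, not_and_or, not_forall, not_le] at hω
    rcases hω with ⟨X, hX, hlt⟩ | ⟨hKb, hlt⟩
    · left
      have hXE : X ⊆ E := hX.trans (sample_subset ω p E)
      set Y := greedyBase r (id : α → α) X with hY
      have hYX : Y ⊆ X := greedyBase_subset _ _ _
      have hYcard : #Y = r X := card_greedyBase hr Function.injective_id X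
      have hYr : r Y = r X := rank_greedyBase hr Function.injective_id X
      have hXY : X ⊆ cl Y := fun x hx => mem_filter.2 ⟨hXE hx, le_antisymm
        ((hr.mono (insert_subset hx hYX)).trans hYr.ge) (hr.le_insert _ _)⟩
      refine Set.mem_biUnion (x := Y) (mem_filter.2 ⟨mem_powerset.2 (hYX.trans hXE), ?_, ?_⟩) ?_
      · rw [← card_pos, hYcard]
        by_contra h0
        have h0 : r X = 0 := by omega
        have := hb X hXE
        rw [h0] at this hlt
        simp only [Nat.cast_zero, mul_zero] at this hlt
        linarith
      · rw [hYr, hYcard]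
      · have hsub : X ⊆ sample ω p (cl Y) := fun x hx =>
          mem_filter.2 ⟨hXY hx, (mem_filter.1 (hX hx)).2⟩
        have h1 : (#X : ℝ) ≤ #(sample ω p (cl Y)) := by exact_mod_cast card_le_card hsub
        rw [Set.mem_ofPred_eq, hYcard, ← mul_assoc]
        linarith
    · right
      rw [if_pos hKb]
      exact hlt.le
  have hY : ∀ Y ∈ 𝓨, labelLaw α {ω | (1 + δ) * (m * #Y) ≤ #(sample ω p (cl Y))} ≤
      ENNReal.ofReal (q ^ #Y) := by
    intro Y hY
    obtain ⟨-, -, hYr⟩ := mem_filter.1 hY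
    have hrcl : r (cl Y) ≤ #Y := by
      rw [← hYr, ← hr.union_eq (Z := cl Y) fun z hz => (mem_filter.1 hz).2]
      exact hr.mono subset_union_right
    have hcard : (p : ℝ) * #(cl Y) ≤ m * #Y := by
      have h1 := hb (cl Y) (filter_subset _ _)
      have h2 : (r (cl Y) : ℝ) ≤ #Y := by exact_mod_cast hrcl
      have hp := p.2.1
      rcases le_or_gt 0 b with hb0 | hb0
      · calc (p : ℝ) * #(cl Y) ≤ p * (b * #Y) :=
              mul_le_mul_of_nonneg_left (h1.trans (mul_le_mul_of_nonneg_left h2 hb0)) hp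
          _ = p * b * #Y := by ring
          _ ≤ m * #Y := mul_le_mul_of_nonneg_right (le_max_left _ _) (Nat.cast_nonneg _)
      · have h3 : (#(cl Y) : ℝ) ≤ 0 :=
          h1.trans (mul_nonpos_of_nonpos_of_nonneg hb0.le (Nat.cast_nonneg _))
        have h4 : 0 ≤ m * #Y := mul_nonneg (hK.le.trans hmK) (Nat.cast_nonneg _)
        nlinarith
    refine (measure_card_sample_ge_le p (cl Y) hδ hδ1 hcard).trans (ENNReal.ofReal_le_ofReal ?_)
    rw [hqdef, ← Real.exp_nat_mul, Real.exp_le_exp]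
    have : δ ^ 2 * K * #Y ≤ δ ^ 2 * m * #Y := by gcongr
    nlinarith
  have hlow : labelLaw α (if K ≤ p * b then
      {ω | (#(sample ω p A) : ℝ) ≤ (1 - δ) * (p * #A)} else ∅) ≤ ENNReal.ofReal q := by
    split_ifs with hKb
    · refine (measure_card_sample_le_le p A hδ hδ1).trans (ENNReal.ofReal_le_ofReal ?_)
      rw [hqdef, Real.exp_le_exp]
      have h1 : K ≤ p * #A := hKb.trans (mul_le_mul_of_nonneg_left hA p.2.1)
      have : δ ^ 2 * K ≤ δ ^ 2 * (p * #A) := by gcongr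
      linarith
    · simp
  -- Summed over all nonempty `Y ⊆ E`, the bounds `q ^ #Y` give `(1 + q) ^ #E - 1`.
  have hsum : ∑ Y ∈ 𝓨, q ^ #Y ≤ 2 * (n * q) := by
    have h1 : ∑ Y ∈ E.powerset, q ^ #Y = (1 + q) ^ #E := by
      rw [add_comm, ← Finset.sum_pow_mul_eq_add_pow]
      simp
    have h2 : ∑ Y ∈ 𝓨, q ^ #Y ≤ ∑ Y ∈ E.powerset.erase ∅, q ^ #Y := by
      refine sum_le_sum_of_subset_of_nonneg (fun Y hY => ?_) fun _ _ _ => by positivity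
      rw [mem_filter] at hY
      exact mem_erase.2 ⟨hY.2.1.ne_empty, hY.1⟩
    have h3 := add_sum_erase E.powerset (fun Y => q ^ #Y) (empty_mem_powerset E)
    rw [h1] at h3
    simp only [card_empty, pow_zero] at h3
    have h4 : (1 + q) ^ #E ≤ Real.exp (n * q) := by
      calc (1 + q) ^ #E ≤ (1 + q) ^ n := pow_le_pow_right₀ (by linarith) hE
        _ ≤ Real.exp q ^ n := by
            refine pow_le_pow_left₀ (by linarith) ?_ _
            rw [add_comm]
            exact Real.add_one_le_exp q
        _ = Real.exp (n * q) := (Real.exp_nat_mul q n).symm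
    have hnq : 0 ≤ n * q := by positivity
    have h5 := (abs_le.1 (Real.abs_exp_sub_one_sub_id_le (x := n * q)
      (by rw [abs_of_nonneg hnq]; exact hq))).2
    nlinarith
  calc labelLaw α {ω | ¬ IsGoodSample r E A b K δ p ω}
      ≤ _ := measure_mono hcover
    _ ≤ _ := measure_union_le _ _
    _ ≤ ∑ Y ∈ 𝓨, ENNReal.ofReal (q ^ #Y) + ENNReal.ofReal q :=
        add_le_add ((measure_biUnion_finset_le _ _).trans (sum_le_sum hY)) hlow
    _ = ENNReal.ofReal (∑ Y ∈ 𝓨, q ^ #Y + q) := by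
        rw [← ENNReal.ofReal_sum_of_nonneg fun _ _ => by positivity,
          ← ENNReal.ofReal_add (sum_nonneg fun _ _ => by positivity) hq0.le]
    _ ≤ ENNReal.ofReal (3 * (n * q)) := by
        refine ENNReal.ofReal_le_ofReal ?_
        have h1 : (1 : ℝ) ≤ n := by exact_mod_cast hn
        nlinarith

end Good

/-! ### The algorithm -/

section Algorithm

variable {α : Type u}

/-- The sampling rate `2⁻ʲ`. -/
noncomputable def rate (j : ℕ) : unitInterval :=
  ⟨(1 / 2) ^ j, by positivity, pow_le_one₀ (by norm_num) (by norm_num)⟩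

lemma coe_rate (j : ℕ) : (rate j : ℝ) = (1 / 2) ^ j := rfl

lemma sample_rate_zero (ω : α → unitInterval) (E : Finset α) : sample ω (rate 0) E = E :=
  filter_true_of_mem fun x _ => by
    have : rate 0 = 1 := Subtype.ext (by simp [coe_rate])
    rw [this]
    exact unitInterval.le_one'

/-- The data maintained by the algorithm: the ground set, the loops, and, for every sampling rate
`rate j`, the loads `loads j i` caused by the first `i` bases of the greedy packing of the sample. -/
structure PackingState (α : Type u) where
  ground : Finset α
  loops : Finset α
  loads : ℕ → ℕ → α → ℕ

lemma eRk_eq_of_indep_iff {M M' : Matroid α} {X : Set α}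
    (h : ∀ I ⊆ X, M'.Indep I ↔ M.Indep I) : M'.eRk X = M.eRk X := by
  refine le_antisymm (Matroid.eRk_le_iff.2 fun I hIX hI => ?_)
    (Matroid.eRk_le_iff.2 fun I hIX hI => ?_)
  · exact ((h I hIX).1 hI).encard_le_eRk_of_subset hIX
  · exact ((h I hIX).2 hI).encard_le_eRk_of_subset hIX

lemma exists_ground_eq {n T : ℕ} {M : ℕ → Matroid α} {w : ℕ → Update α}
    (h : IsDynamicMatroid n T M w) {t : ℕ} (ht : t ≤ T) :
    ∃ E : Finset α, (E : Set α) = (M t).E ∧ #E ≤ n := by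
  have hc := h.card_le t ht
  have hfin : (M t).E.Finite := Set.finite_of_encard_le_coe hc
  refine ⟨hfin.toFinset, hfin.coe_toFinset, ?_⟩
  rw [hfin.encard_eq_coe_toFinset_card] at hc
  exact_mod_cast hc

variable [LinearOrder α]

lemma sample_insert_of_le {ω : α → unitInterval} {p : unitInterval} {e : α} (h : ω e ≤ p)
    (E : Finset α) : sample ω p (insert e E) = insert e (sample ω p E) := by
  rw [sample, filter_insert, if_pos h, sample]

lemma sample_insert_of_not_le {ω : α → unitInterval} {p : unitInterval} {e : α} (h : ¬ ω e ≤ p)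
    (E : Finset α) : sample ω p (insert e E) = sample ω p E := by
  rw [sample, filter_insert, if_neg h, sample]

/-- The state for the ground set `E` with rank function `r`, with `k` bases for each of `J` sampling
rates. It does not depend on the past. -/
noncomputable def canonicalState (ω : α → unitInterval) (J k : ℕ) (r : Finset α → ℕ)
    (E : Finset α) : PackingState α where
  ground := E
  loops := {x ∈ E | r {x} = 0}
  loads j := if j < J then fun m => load r (sample ω (rate j) E) (min m k) else default

lemma canonicalState_congr (ω : α → unitInterval) (J k : ℕ) {r r' : Finset α → ℕ} {E : Finset α}
    (h : ∀ X ⊆ E, r X = r' X) : canonicalState ω J k r E = canonicalState ω J k r' E := by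
  simp only [canonicalState, PackingState.mk.injEq, true_and]
  refine ⟨filter_congr fun x hx => by rw [h _ (singleton_subset_iff.2 hx)], funext fun j => ?_⟩
  split_ifs
  · funext m
    rw [load_congr fun X hX => h X (hX.trans (sample_subset _ _ _))]
  · rfl

/-- The estimate obtained from the sample with rate `rate j`, not yet scaled. -/
noncomputable def PackingState.levelEstimate (ω : α → unitInterval) (k : ℕ) (σ : PackingState α)
    (j : ℕ) : ℝ≥0∞ :=
  loadEstimate k (σ.loads j k) (sample ω (rate j) σ.ground)

open Classical in
/-- The estimate of the covering number: the scaled estimate of the first sample, in the order of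
decreasing rates, whose estimate does not exceed the threshold `K`; it is `∞` if there are loops. -/
noncomputable def PackingState.estimate (ω : α → unitInterval) (J k : ℕ) (K : ℝ)
    (σ : PackingState α) : ℝ≥0∞ :=
  if σ.loops.Nonempty then ⊤
  else if h : ∃ j, j < J ∧ σ.levelEstimate ω k j ≤ ENNReal.ofReal K then
    σ.levelEstimate ω k (Nat.find h) * 2 ^ Nat.find h
  else 0

open Classical in
/-- The algorithm for the labels `ω`. It keeps `k` bases for each of `J` sampling rates and
corrects them by bisection, for ground sets of at most `2 ^ s` elements. The preprocessing, whose
queries are not counted, learns the ranks of all subsets of the initial ground set. -/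
noncomputable def packingAlgorithm (ω : α → unitInterval) (J s k : ℕ) (K : ℝ) : Algorithm α where
  State := PackingState α
  init E := if h : E.Finite then
      (RankProgram.learn h.toFinset.powerset.toList).bind fun r =>
        .ret (canonicalState ω J k r h.toFinset)
    else .ret ⟨∅, ∅, default⟩
  update σ
    | .insert e => .query {e} fun q =>
        (RankProgram.sequence (fun j =>
          if ω e ≤ rate j then
            rebuild (insert e (sample ω (rate j) σ.ground))
              (insertGuess (sample ω (rate j) σ.ground) e (σ.loads j)) s k
          else .ret (σ.loads j)) J).bind fun L =>
        .ret ⟨insert e σ.ground, if q = 0 then insert e σ.loops else σ.loops, L⟩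
    | .delete e =>
        (RankProgram.sequence (fun j =>
          if ω e ≤ rate j then
            rebuild ((sample ω (rate j) σ.ground).erase e)
              (deleteGuess ((sample ω (rate j) σ.ground).erase e) e (σ.loads j)) s k
          else .ret (σ.loads j)) J).bind fun L =>
        .ret ⟨σ.ground.erase e, σ.loops.erase e, L⟩
  output := PackingState.estimate ω J k K

lemma packingAlgorithm_update_insert (ω : α → unitInterval) {J s k : ℕ} {K : ℝ} {M M' : Matroid α}
    {E : Finset α} {e : α} (hE : (E : Set α) = M.E) (hstep : (Update.insert e).Step M M')
    (hcard : #(insert e E) ≤ 2 ^ s) :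
    ((packingAlgorithm ω J s k K).update (canonicalState ω J k (finRank M) E)
        (.insert e)).result M' = canonicalState ω J k (finRank M') (insert e E) ∧
      ((packingAlgorithm ω J s k K).update (canonicalState ω J k (finRank M) E)
        (.insert e)).numQueries M' ≤ J * (k + k * k * s) + 1 := by
  obtain ⟨he, -, hind⟩ := hstep
  have heE : e ∉ E := fun h => he (hE ▸ (by exact_mod_cast h))
  have hrank : ∀ X ⊆ E, finRank M X = finRank M' X := fun X hX => by
    rw [finRank, finRank, eRk_eq_of_indep_iff fun I hI => hind I fun heI => heE
      (hX (by exact_mod_cast hI heI))]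
  rw [canonicalState_congr ω J k hrank]
  have hlevel : ∀ j < J, ω e ≤ rate j →
      _ := fun j hj _ => rebuild_insertGuess_spec (A := sample ω (rate j) E) (e := e)
        (M := M') (s := s) (fun h => heE (sample_subset _ _ _ h))
        ((card_le_card (insert_subset_insert _ (sample_subset _ _ _))).trans hcard) k
        (L := (canonicalState ω J k (finRank M') E).loads j) (by simp [canonicalState, hj])
  constructor
  · simp only [packingAlgorithm, RankProgram.result_query, RankProgram.result_bind,
      RankProgram.result_ret, RankProgram.result_sequence]
    simp only [canonicalState, PackingState.mk.injEq, true_and]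
    refine ⟨?_, funext fun j => ?_⟩
    · rw [filter_insert, finRank, coe_singleton]
    · split_ifs with hj hle
      · have := (hlevel j hj hle).1
        simp only [canonicalState, if_pos hj] at this
        rw [this, sample_insert_of_le hle]
      · rw [RankProgram.result_ret, sample_insert_of_not_le hle]
      · rfl
  · simp only [packingAlgorithm, RankProgram.numQueries_query, RankProgram.numQueries_bind,
      RankProgram.numQueries_ret, add_zero]
    refine Nat.add_le_add_right (RankProgram.numQueries_sequence_le _ _ fun j hj => ?_) 1
    split_ifs with hle
    · exact (hlevel j hj hle).2
    · exact Nat.zero_le _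

lemma packingAlgorithm_update_delete (ω : α → unitInterval) {J s k : ℕ} {K : ℝ} {M M' : Matroid α}
    {E : Finset α} {e : α} (hE : (E : Set α) = M.E) (hstep : (Update.delete e).Step M M')
    (hcard : #E ≤ 2 ^ s) :
    ((packingAlgorithm ω J s k K).update (canonicalState ω J k (finRank M) E)
        (.delete e)).result M' = canonicalState ω J k (finRank M') (E.erase e) ∧
      ((packingAlgorithm ω J s k K).update (canonicalState ω J k (finRank M) E)
        (.delete e)).numQueries M' ≤ J * (k + k * k * s) + 1 := by
  obtain ⟨he, -, hind⟩ := hstep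
  have heE : e ∈ E := by
    have : e ∈ (E : Set α) := hE ▸ he
    exact_mod_cast this
  have hrank : ∀ X ⊆ E.erase e, finRank M X = finRank M' X := fun X hX => by
    have heX : e ∉ X := fun h => notMem_erase e E (hX h)
    rw [finRank, finRank, eRk_eq_of_indep_iff fun I hI => (hind I).trans
      (and_iff_left fun heI => heX (by exact_mod_cast hI heI))]
  have hsample : ∀ j, sample ω (rate j) (E.erase e) = (sample ω (rate j) E).erase e :=
    fun j => filter_erase _ _ _
  have hlevel : ∀ j < J, ω e ≤ rate j →
      _ := fun j hj hle => rebuild_deleteGuess_spec (A := (sample ω (rate j) E).erase e) (e := e)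
        (M := M') (s := s) (notMem_erase _ _) (isRankFunction_finRank M)
        (fun X hX => hrank X (hX.trans (erase_subset_erase _ (sample_subset _ _ _))))
        ((card_le_card ((erase_subset _ _).trans (sample_subset _ _ _))).trans hcard) k
        (L := (canonicalState ω J k (finRank M) E).loads j) (by
          rw [insert_erase (show e ∈ sample ω (rate j) E from mem_filter.2 ⟨heE, hle⟩)]
          simp [canonicalState, hj])
  constructor
  · simp only [packingAlgorithm, RankProgram.result_bind,
      RankProgram.result_ret, RankProgram.result_sequence]
    simp only [canonicalState, PackingState.mk.injEq, true_and]
    refine ⟨?_, funext fun j => ?_⟩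
    · rw [← filter_erase]
      refine filter_congr fun x hx => ?_
      rw [hrank _ (singleton_subset_iff.2 hx)]
    · split_ifs with hj hle
      · have := (hlevel j hj hle).1
        simp only [canonicalState, if_pos hj] at this
        rw [this, hsample]
      · rw [RankProgram.result_ret, hsample]
        have hnot : e ∉ sample ω (rate j) E := fun h => hle (mem_filter.1 h).2
        have hsub : sample ω (rate j) E ⊆ E.erase e := fun x hx =>
          mem_erase.2 ⟨fun h => hnot (h ▸ hx), sample_subset _ _ _ hx⟩
        rw [erase_eq_of_notMem hnot]
        funext m
        rw [load_congr fun X hX => hrank X (hX.trans hsub)]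
      · rfl
  · simp only [packingAlgorithm, RankProgram.numQueries_bind,
      RankProgram.numQueries_ret, add_zero]
    refine (RankProgram.numQueries_sequence_le _ _ fun j hj => ?_).trans (Nat.le_succ _)
    split_ifs with hle
    · exact (hlevel j hj hle).2
    · exact Nat.zero_le _

/-- An update leads from a canonical state to a canonical state, with few queries. -/
lemma packingAlgorithm_update (ω : α → unitInterval) {J s k : ℕ} {K : ℝ} {M M' : Matroid α}
    {E E' : Finset α} {u : Update α} (hE : (E : Set α) = M.E) (hE' : (E' : Set α) = M'.E)
    (hstep : u.Step M M') (hcard : #E ≤ 2 ^ s) (hcard' : #E' ≤ 2 ^ s) :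
    ((packingAlgorithm ω J s k K).update (canonicalState ω J k (finRank M) E) u).result M' =
        canonicalState ω J k (finRank M') E' ∧
      ((packingAlgorithm ω J s k K).update (canonicalState ω J k (finRank M) E) u).numQueries M' ≤
        J * (k + k * k * s) + 1 := by
  cases u with
  | insert e =>
    obtain rfl : E' = insert e E := by
      rw [← coe_inj, hE', hstep.2.1, coe_insert, hE]
    exact packingAlgorithm_update_insert ω hE hstep hcard'
  | delete e =>
    obtain rfl : E' = E.erase e := by
      rw [← coe_inj, hE', hstep.2.1, coe_erase, hE]
    exact packingAlgorithm_update_delete ω hE hstep hcard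

lemma state_packingAlgorithm (ω : α → unitInterval) {n T J s k : ℕ} {K : ℝ} {M : ℕ → Matroid α}
    {w : ℕ → Update α} (h : IsDynamicMatroid n T M w) (hs : n ≤ 2 ^ s) (t : ℕ) :
    t ≤ T → ∀ E : Finset α, (E : Set α) = (M t).E →
      (packingAlgorithm ω J s k K).state M w t = canonicalState ω J k (finRank (M t)) E := by
  induction t with
  | zero =>
    intro _ E hE
    have hfin : (M 0).E.Finite := hE ▸ E.finite_toSet
    have hE' : hfin.toFinset = E := by rw [← coe_inj, hfin.coe_toFinset, hE]
    simp only [Algorithm.state, packingAlgorithm, dif_pos hfin, hE', RankProgram.result_bind,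
      RankProgram.result_ret]
    exact canonicalState_congr ω J k fun X hX => result_learn _ (mem_toList.2 (mem_powerset.2 hX))
  | succ t ih =>
    intro ht E' hE'
    obtain ⟨E, hE, hEn⟩ := exists_ground_eq h (Nat.le_of_succ_le ht)
    obtain ⟨E'', hE'', hEn'⟩ := exists_ground_eq h ht
    obtain rfl : E' = E'' := by rw [← coe_inj, hE', hE'']
    rw [Algorithm.state, ih (Nat.le_of_succ_le ht) E hE]
    exact (packingAlgorithm_update ω hE hE' (h.step t ht) (hEn.trans hs) (hEn'.trans hs)).1

lemma updateQueries_packingAlgorithm_le (ω : α → unitInterval) {n T J s k : ℕ} {K : ℝ}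
    {M : ℕ → Matroid α} {w : ℕ → Update α} (h : IsDynamicMatroid n T M w) (hs : n ≤ 2 ^ s)
    {t : ℕ} (ht : t < T) :
    (packingAlgorithm ω J s k K).updateQueries M w t ≤ J * (k + k * k * s) + 1 := by
  obtain ⟨E, hE, hEn⟩ := exists_ground_eq h ht.le
  obtain ⟨E', hE', hEn'⟩ := exists_ground_eq h ht
  rw [Algorithm.updateQueries, state_packingAlgorithm ω h hs t ht.le E hE]
  exact (packingAlgorithm_update ω hE hE' (h.step t ht) (hEn.trans hs) (hEn'.trans hs)).2

end Algorithm

/-! ### Quality of the estimate -/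

section Quality

variable {α : Type u}

lemma div_le_coveringNumber {M : Matroid α} {E X : Finset α} (hE : (E : Set α) = M.E)
    (hX : X ⊆ E) (hne : X.Nonempty) :
    (#X : ℝ≥0∞) / (finRank M X : ℝ≥0∞) ≤ coveringNumber M := by
  have h : (X : Set α) ∈ {A : Set α | A ⊆ M.E ∧ A.Nonempty} :=
    ⟨hE ▸ (by exact_mod_cast hX), by exact_mod_cast hne⟩
  refine le_trans (le_of_eq ?_) (le_iSup₂ (f := fun (A : Set α)
    (_ : A ∈ {A : Set α | A ⊆ M.E ∧ A.Nonempty}) =>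
      (A.encard : ℝ≥0∞) / (M.eRk A : ℝ≥0∞)) (X : Set α) h)
  rw [← coe_finRank, Set.encard_coe_eq_coe_finsetCard, ENat.toENNReal_coe, ENat.toENNReal_coe]

lemma coveringNumber_le {M : Matroid α} {E : Finset α} (hE : (E : Set α) = M.E) {b : ℝ≥0∞}
    (h : ∀ X ⊆ E, X.Nonempty → (#X : ℝ≥0∞) / (finRank M X : ℝ≥0∞) ≤ b) :
    coveringNumber M ≤ b := by
  refine iSup₂_le fun A hA => ?_
  have hfin : A.Finite := E.finite_toSet.subset (hE ▸ hA.1)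
  obtain ⟨X, rfl⟩ := hfin.exists_finset_coe
  rw [← coe_finRank, Set.encard_coe_eq_coe_finsetCard, ENat.toENNReal_coe, ENat.toENNReal_coe]
  refine h X ?_ (by exact_mod_cast hA.2)
  have := hA.1
  rw [← hE] at this
  exact_mod_cast this

variable [LinearOrder α]

/-- A matroid without loops has a set of greatest density, and its density is the covering
number. -/
lemma exists_densest {M : Matroid α} {E : Finset α} (hE : (E : Set α) = M.E) (hne : E.Nonempty)
    (hloop : ∀ x ∈ E, finRank M {x} ≠ 0) :
    ∃ A ⊆ E, ∃ b : ℝ, 1 ≤ b ∧ (#A : ℝ) = b * finRank M A ∧ b ≤ #A ∧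
      (∀ X ⊆ E, (#X : ℝ) ≤ b * finRank M X) ∧ coveringNumber M = ENNReal.ofReal b := by
  have hr := isRankFunction_finRank M
  have hpos : ∀ X ⊆ E, X.Nonempty → 1 ≤ finRank M X := by
    rintro X hX ⟨x, hx⟩
    have h1 := hr.mono (singleton_subset_iff.2 hx)
    have h2 := hloop x (hX hx)
    omega
  obtain ⟨A, hA, hmax⟩ := exists_max_image {X ∈ E.powerset | X.Nonempty}
    (fun X => (#X : ℝ) / finRank M X) ⟨E, by simp [hne]⟩
  simp only [mem_filter, mem_powerset] at hA hmax
  have hA1 : (1 : ℝ) ≤ finRank M A := by exact_mod_cast hpos A hA.1 hA.2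
  have hb1 : (1 : ℝ) ≤ #A / finRank M A := by
    rw [le_div_iff₀ (by linarith), one_mul]
    exact_mod_cast hr.le_card A
  refine ⟨A, hA.1, #A / finRank M A, hb1, ?_, ?_, ?_, le_antisymm ?_ ?_⟩
  · rw [div_mul_cancel₀ _ (by linarith)]
  · exact div_le_self (Nat.cast_nonneg _) hA1
  · intro X hX
    rcases X.eq_empty_or_nonempty with rfl | hXne
    · simp only [card_empty, Nat.cast_zero]
      positivity
    · have h1 : (1 : ℝ) ≤ finRank M X := by exact_mod_cast hpos X hX hXne
      exact (div_le_iff₀ (by linarith)).1 (hmax X ⟨hX, hXne⟩)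
  · refine coveringNumber_le hE fun X hX hXne => ?_
    have h1 : (1 : ℝ) ≤ finRank M X := by exact_mod_cast hpos X hX hXne
    rw [← ENNReal.ofReal_natCast, ← ENNReal.ofReal_natCast,
      ← ENNReal.ofReal_div_of_pos (by linarith)]
    exact ENNReal.ofReal_le_ofReal (hmax X ⟨hX, hXne⟩)
  · rw [ENNReal.ofReal_div_of_pos (by linarith), ENNReal.ofReal_natCast, ENNReal.ofReal_natCast]
    exact div_le_coveringNumber hE hA.1 hA.2

/-- If all samples are good, then the first one with a small estimate has a rate `p` such that
`p b` is large enough for concentration and small enough for the number of bases in a packing. -/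
lemma isApprox_estimate_of_good {r : Finset α → ℕ} (hr : IsRankFunction r) {E A : Finset α}
    {ω : α → unitInterval} {b K δ ε : ℝ} {n s k : ℕ} (hE : #E ≤ n) (hs : n ≤ 2 ^ s)
    (hAE : A ⊆ E) (hA : (#A : ℝ) = b * r A) (hb1 : 1 ≤ b) (hbA : b ≤ #A)
    (hb : ∀ X ⊆ E, (#X : ℝ) ≤ b * r X) (hK : 1 ≤ K) (hδ : 0 < δ) (hε : ε < 1 / 2)
    (hδε : δ = ε / 3) (hk0 : 0 < k) (hk : 16 * (16 * K) * Real.log n / δ ^ 2 ≤ k)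
    (hloop : ∀ x ∈ E, r {x} ≠ 0)
    (hgood : ∀ j < s + 1, IsGoodSample r E A b K δ (rate j) ω) :
    IsApprox ε ((canonicalState ω (s + 1) k r E).estimate ω (s + 1) k (8 * K))
      (ENNReal.ofReal b) := by
  classical
  have hδ6 : δ ≤ 1 / 6 := by linarith
  have hδ1 : δ ≤ 1 := by linarith
  have hApos : (0 : ℝ) < #A := by linarith
  have hAne : A.Nonempty := card_pos.1 (by exact_mod_cast hApos)
  have hrA : (0 : ℝ) < r A := by
    by_contra h
    have h0 : (r A : ℝ) = 0 := le_antisymm (not_lt.1 h) (Nat.cast_nonneg _)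
    rw [h0, mul_zero] at hA
    linarith
  set p : ℕ → ℝ := fun j => (1 / 2) ^ j with hp
  have hppos : ∀ j, 0 < p j := fun j => by positivity
  set est : ℕ → ℝ≥0∞ := fun j =>
    loadEstimate k (load r (sample ω (rate j) E) k) (sample ω (rate j) E) with hest
  have hestj : ∀ j < s + 1, (canonicalState ω (s + 1) k r E).levelEstimate ω k j = est j := by
    intro j hj
    simp only [PackingState.levelEstimate, canonicalState, if_pos hj, min_self, hest]
  have hupper : ∀ (j : ℕ) (B : ℝ), 0 < B → B ≤ 16 * K →
      (∀ X ⊆ sample ω (rate j) E, (#X : ℝ) ≤ B * r X) → est j ≤ ENNReal.ofReal ((1 + δ) * B) := by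
    intro j B hB hBK hX
    refine loadEstimate_le hr hδ hδ1 hB hX ((card_le_card (sample_subset _ _ _)).trans hE) hk0
      (le_trans ?_ hk)
    have : 0 ≤ Real.log n := Real.log_natCast_nonneg n
    gcongr
  have hgoodupper : ∀ j < s + 1, (1 + δ) * max (p j * b) K ≤ 16 * K →
      est j ≤ ENNReal.ofReal ((1 + δ) * ((1 + δ) * max (p j * b) K)) := by
    intro j hj hle
    have hmax : K ≤ max (p j * b) K := le_max_right _ _
    exact hupper j _ (mul_pos (by linarith) (by linarith)) hle (hgood j hj).1
  -- At the least rate, `p b ≤ 1 ≤ K`, so the estimate is small.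
  have hex : ∃ j, j < s + 1 ∧
      (canonicalState ω (s + 1) k r E).levelEstimate ω k j ≤ ENNReal.ofReal (8 * K) := by
    refine ⟨s, Nat.lt_succ_self s, ?_⟩
    rw [hestj s (Nat.lt_succ_self s)]
    have hps : p s * b ≤ 1 := by
      have h1 : b ≤ 2 ^ s := by
        have h2 : (#A : ℝ) ≤ 2 ^ s := by
          exact_mod_cast (card_le_card hAE).trans (hE.trans hs)
        linarith
      calc p s * b ≤ p s * 2 ^ s := mul_le_mul_of_nonneg_left h1 (hppos s).le
        _ = 1 := by rw [hp, ← mul_pow]; norm_num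
    have hmax : max (p s * b) K = K := max_eq_right (hps.trans hK)
    refine (hgoodupper s (Nat.lt_succ_self s) ?_).trans (ENNReal.ofReal_le_ofReal ?_) <;>
      rw [hmax]
    · nlinarith
    · have h3 : (1 + δ) * K ≤ 2 * K := mul_le_mul_of_nonneg_right (by linarith) (by linarith)
      nlinarith
  have hnoloop : ¬ (canonicalState ω (s + 1) k r E).loops.Nonempty := by
    rintro ⟨x, hx⟩
    obtain ⟨hxE, hx0⟩ := mem_filter.1 hx
    exact hloop x hxE hx0
  rw [PackingState.estimate, if_neg hnoloop, dif_pos hex]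
  obtain ⟨hJ, hsmall⟩ := Nat.find_spec hex
  have hmin : ∀ i < Nat.find hex, ENNReal.ofReal (8 * K) < est i := by
    intro i hi
    have h1 := Nat.find_min hex hi
    have h2 : i < s + 1 := hi.trans hJ
    rw [← hestj i h2]
    exact not_le.1 fun h => h1 ⟨h2, h⟩
  generalize Nat.find hex = j at hJ hsmall hmin
  rw [hestj j hJ] at hsmall ⊢
  have hgoal : ∀ lo hi : ℝ, (1 - ε) * b ≤ lo * 2 ^ j → hi * 2 ^ j ≤ (1 + ε) * b →
      0 ≤ lo → ENNReal.ofReal lo ≤ est j → est j ≤ ENNReal.ofReal hi →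
      IsApprox ε (est j * 2 ^ j) (ENNReal.ofReal b) := by
    intro lo hi h1 h2 h0 h3 h4
    have h2j : (2 : ℝ≥0∞) ^ j = ENNReal.ofReal (2 ^ j) := by
      rw [ENNReal.ofReal_pow (by norm_num)]
      norm_num
    constructor
    · rw [← ENNReal.ofReal_mul (by linarith), h2j]
      refine (ENNReal.ofReal_le_ofReal h1).trans ?_
      rw [ENNReal.ofReal_mul h0]
      gcongr
    · rw [← ENNReal.ofReal_mul (by linarith), h2j]
      refine le_trans ?_ (ENNReal.ofReal_le_ofReal h2)
      rw [ENNReal.ofReal_mul' (by positivity)]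
      gcongr
  have hdens : ∀ X ⊆ sample ω (rate j) E, X ⊆ A → X.Nonempty →
      ENNReal.ofReal (#X / r A) ≤ est j := by
    intro X hX hXA hne
    refine le_trans ?_ (div_le_loadEstimate hr hk0 hX hne)
    rw [ENNReal.ofReal_div_of_pos hrA, ENNReal.ofReal_natCast, ENNReal.ofReal_natCast]
    have : r X ≤ r A := hr.mono hXA
    gcongr
  rcases Nat.eq_zero_or_pos j with rfl | hjpos
  · -- The sample of rate `1` is the whole ground set.
    have hs0 := sample_rate_zero ω E
    have hlo : ENNReal.ofReal b ≤ est 0 := by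
      have := hdens A (hs0.symm ▸ hAE) Subset.rfl hAne
      rwa [hA, mul_div_assoc, div_self hrA.ne', mul_one] at this
    have hb8 : b ≤ 8 * K :=
      (ENNReal.ofReal_le_ofReal_iff (by linarith)).1 (hlo.trans hsmall)
    have hhi := hupper 0 b (by linarith) (by linarith) (by rw [hs0]; exact hb)
    refine hgoal b ((1 + δ) * b) ?_ ?_ (by linarith) hlo hhi <;> rw [pow_zero, mul_one] <;>
      nlinarith
  · -- The preceding rate is `2 p`, and its estimate is large, which would fail if `p b < K`.
    have hpb : K ≤ p j * b := by
      by_contra hlt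
      have hprev : p (j - 1) = 2 * p j := by
        obtain ⟨i, rfl⟩ := Nat.exists_eq_succ_of_ne_zero hjpos.ne'
        simp only [hp, Nat.succ_eq_add_one, Nat.add_sub_cancel, pow_succ]
        ring
      have hmax : max (p (j - 1) * b) K ≤ 2 * K := by
        rw [hprev]
        exact max_le (by linarith) (by linarith)
      have h1 := hgoodupper (j - 1) (by omega) (by nlinarith)
      have h2 := hmin (j - 1) (by omega)
      refine absurd (h2.trans_le h1) (not_lt.2 (ENNReal.ofReal_le_ofReal ?_))
      have h3 : (1 + δ) * max (p (j - 1) * b) K ≤ 2 * (2 * K) :=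
        mul_le_mul (by linarith) hmax (le_trans (by linarith) (le_max_right _ _)) (by norm_num)
      nlinarith
    have hcard := (hgood j hJ).2 hpb
    have hpA : 0 < (1 - δ) * (p j * #A) :=
      mul_pos (by linarith) (mul_pos (hppos j) hApos)
    have hlo : ENNReal.ofReal ((1 - δ) * (p j * b)) ≤ est j := by
      have hne : (sample ω (rate j) A).Nonempty :=
        card_pos.1 (by exact_mod_cast lt_of_lt_of_le hpA hcard)
      refine le_trans (ENNReal.ofReal_le_ofReal ?_) (hdens (sample ω (rate j) A)
        (filter_subset_filter _ hAE) (sample_subset _ _ _) hne)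
      rw [le_div_iff₀ hrA]
      refine le_trans (le_of_eq ?_) hcard
      rw [hA, coe_rate]
      ring
    have hpb8 : (1 - δ) * (p j * b) ≤ 8 * K :=
      (ENNReal.ofReal_le_ofReal_iff (by linarith)).1 (hlo.trans hsmall)
    -- As `δ` is small, `(1 + δ) p b ≤ 16 K` follows, so the packing has enough bases for the upper bound.
    have hmax : max (p j * b) K = p j * b := max_eq_left hpb
    have hhi := hgoodupper j hJ (by rw [hmax]; nlinarith)
    rw [hmax] at hhi
    have hcancel : p j * 2 ^ j = 1 := by
      rw [hp, ← mul_pow]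
      norm_num
    refine hgoal _ _ (le_of_le_of_eq ?_ (show (1 - δ) * b = _ from ?_))
      (le_of_eq_of_le (show _ = (1 + δ) * (1 + δ) * b from ?_) ?_)
      (mul_nonneg (by linarith) (mul_nonneg (hppos j).le (by linarith))) hlo hhi
    · nlinarith
    · rw [mul_assoc, mul_right_comm (p j), hcancel, one_mul]
    · rw [mul_assoc, mul_assoc, mul_right_comm (p j), hcancel, one_mul, mul_assoc]
    · exact mul_le_mul_of_nonneg_right (by nlinarith) (by linarith)

open MeasureTheory in
lemma measure_not_isApprox_le {M : Matroid α} {E : Finset α} (hEM : (E : Set α) = M.E)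
    {K δ ε : ℝ} {n s k : ℕ} (hE : #E ≤ n) (hn : 1 ≤ n) (hs : n ≤ 2 ^ s) (hK : 1 ≤ K) (hε0 : 0 < ε)
    (hε : ε < 1 / 2) (hδε : δ = ε / 3) (hk0 : 0 < k)
    (hk : 16 * (16 * K) * Real.log n / δ ^ 2 ≤ k)
    (hq : n * Real.exp (-(δ ^ 2 * K / 4)) ≤ 1) :
    labelLaw α {ω | ¬ IsApprox ε ((canonicalState ω (s + 1) k (finRank M) E).estimate ω (s + 1) k
        (8 * K)) (coveringNumber M)} ≤
      ENNReal.ofReal ((s + 1 : ℕ) * (3 * (n * Real.exp (-(δ ^ 2 * K / 4))))) := by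
  have hr := isRankFunction_finRank M
  have hδ : 0 < δ := by linarith
  by_cases hloop : ∀ x ∈ E, finRank M {x} ≠ 0
  swap
  · push Not at hloop
    obtain ⟨x, hx, hx0⟩ := hloop
    have htop : coveringNumber M = ⊤ := by
      have := div_le_coveringNumber hEM (singleton_subset_iff.2 hx) (singleton_nonempty x)
      rw [hx0, Nat.cast_zero, ENNReal.div_zero (by simp)] at this
      exact top_le_iff.1 this
    have hall : ∀ ω : α → unitInterval, IsApprox ε ((canonicalState ω (s + 1) k (finRank M)
        E).estimate ω (s + 1) k (8 * K)) (coveringNumber M) := by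
      intro ω
      rw [PackingState.estimate, if_pos ⟨x, mem_filter.2 ⟨hx, hx0⟩⟩, htop]
      refine ⟨le_top, ?_⟩
      rw [ENNReal.mul_top (by simp; linarith)]
    simp [hall]
  rcases E.eq_empty_or_nonempty with rfl | hne
  · have hzero : coveringNumber M = 0 := le_antisymm (coveringNumber_le hEM fun X hX hne =>
      absurd (subset_empty.1 hX) hne.ne_empty) zero_le
    have hall : ∀ ω : α → unitInterval, IsApprox ε ((canonicalState ω (s + 1) k (finRank M)
        ∅).estimate ω (s + 1) k (8 * K)) (coveringNumber M) := by
      intro ω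
      have hlev : ∀ j, (canonicalState ω (s + 1) k (finRank M) ∅).levelEstimate ω k j = 0 := by
        intro j
        simp [PackingState.levelEstimate, canonicalState, loadEstimate, sample]
      rw [hzero, PackingState.estimate, if_neg (by simp [canonicalState])]
      split_ifs with h
      · simp [hlev, IsApprox]
      · simp [IsApprox]
    simp [hall]
  obtain ⟨A, hAE, b, hb1, hA, hbA, hb, hcov⟩ := exists_densest hEM hne hloop
  calc _ ≤ labelLaw α (⋃ j ∈ range (s + 1),
        {ω | ¬ IsGoodSample (finRank M) E A b K δ (rate j) ω}) := by
        refine measure_mono fun ω hω => ?_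
        by_contra hcon
        simp only [Set.mem_iUnion, Set.mem_ofPred_eq, not_exists, not_not, mem_range] at hcon
        refine hω ?_
        rw [hcov]
        exact isApprox_estimate_of_good hr hE hs hAE hA hb1 hbA hb hK hδ hε hδε hk0 hk hloop hcon
    _ ≤ ∑ j ∈ range (s + 1), ENNReal.ofReal (3 * (n * Real.exp (-(δ ^ 2 * K / 4)))) :=
        (measure_biUnion_finset_le _ _).trans (sum_le_sum fun j _ =>
          measure_not_isGoodSample_le hr (rate j) hδ (by linarith) (by linarith) hb hbA hE hn hq)
    _ = _ := by
        rw [sum_const, card_range, nsmul_eq_mul, ENNReal.ofReal_mul (Nat.cast_nonneg _),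
          ENNReal.ofReal_natCast]

end Quality

/-! ### The choice of the parameters -/

section Parameters

lemma clog_two_le {n : ℕ} (hn : 2 ≤ n) : (Nat.clog 2 n : ℝ) ≤ 3 * Real.log n := by
  have h1 : Real.log 2 ≤ Real.log n := Real.log_le_log (by norm_num) (by exact_mod_cast hn)
  have h2 := Real.log_two_gt_d9
  have h3 : 2 ^ (Nat.clog 2 n).pred < n := Nat.pow_pred_clog_lt_self (by norm_num) (by omega)
  have h4 : ((Nat.clog 2 n).pred : ℝ) * Real.log 2 ≤ Real.log n := by
    rw [← Real.log_pow]
    exact Real.log_le_log (by positivity) (by exact_mod_cast h3.le)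
  have h5 : 0 < Nat.clog 2 n := Nat.clog_pos (by norm_num) hn
  have h6 : ((Nat.clog 2 n).pred : ℝ) = Nat.clog 2 n - 1 := by
    rw [Nat.pred_eq_sub_one, Nat.cast_sub h5, Nat.cast_one]
  rw [h6] at h4
  have h7 : (1 : ℝ) ≤ Nat.clog 2 n := by exact_mod_cast h5
  nlinarith

/-- The number of queries, in terms of the number `k ≈ log² n / ε⁴` of bases in each of
`s + 1 ≈ log n` packings. -/
lemma query_bound {n s k : ℕ} {D ε : ℝ} (hn : 2 ≤ n) (hs : s = Nat.clog 2 n) (hε : 0 < ε)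
    (hD : 0 < D) (hk1 : 1 ≤ k) (hk : (k : ℝ) ≤ D * (Real.log n ^ 2 / ε ^ 4)) :
    (((s + 1) * (k + k * k * s) + 1 : ℕ) : ℝ) ≤ 45 * D ^ 2 * Real.log n ^ 6 / ε ^ 8 := by
  set l := Real.log n with hl
  have hl2 : Real.log 2 ≤ l := Real.log_le_log (by norm_num) (by exact_mod_cast hn)
  have h2 := Real.log_two_gt_d9
  have hs3 : (s : ℝ) ≤ 3 * l := hs ▸ clog_two_le hn
  have hs1 : (1 : ℝ) ≤ s := by
    rw [hs]
    exact_mod_cast Nat.clog_pos (by norm_num) hn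
  have hk1' : (1 : ℝ) ≤ k := by exact_mod_cast hk1
  have hJ : (s : ℝ) + 1 ≤ 5 * l := by linarith
  have hkk : (k : ℝ) ≤ k * k * s := by
    nlinarith [mul_nonneg (by linarith : (0 : ℝ) ≤ k - 1) (by linarith : (0 : ℝ) ≤ k),
      mul_nonneg (by positivity : (0 : ℝ) ≤ k * k) (by linarith : (0 : ℝ) ≤ s - 1)]
  have hone : (1 : ℝ) ≤ (s + 1) * (k * k * s) := by nlinarith
  push_cast
  calc ((s : ℝ) + 1) * (k + k * k * s) + 1 ≤ 3 * ((s + 1) * (k * k * s)) := by nlinarith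
    _ ≤ 3 * (5 * l * ((D * (l ^ 2 / ε ^ 4)) * (D * (l ^ 2 / ε ^ 4)) * (3 * l))) := by gcongr
    _ = 45 * D ^ 2 * l ^ 6 / ε ^ 8 := by
        field_simp
        ring

/-- The union bound over `T + 1` moments and `s + 1` sampling rates. -/
lemma failure_bound {n s T : ℕ} {c : ℝ} (hn : 2 ≤ n) (hs : s = Nat.clog 2 n) (hc : 0 < c)
    (hT : (T : ℝ) ≤ (n : ℝ) ^ c) :
    ((T + 1 : ℕ) : ℝ) * ((s + 1 : ℕ) * (3 * (n * (n : ℝ) ^ (-(2 * c + 6))))) ≤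
      (n : ℝ) ^ (-c) := by
  have hn2 : (2 : ℝ) ≤ n := by exact_mod_cast hn
  have hn0 : (0 : ℝ) < n := by linarith
  have h1 : ((T + 1 : ℕ) : ℝ) ≤ n * (n : ℝ) ^ c := by
    push_cast
    have : 1 ≤ (n : ℝ) ^ c := Real.one_le_rpow (by linarith) hc.le
    nlinarith
  have h2 : ((s + 1 : ℕ) : ℝ) ≤ n ^ 2 := by
    have hle : s ≤ n := hs ▸ Nat.clog_le_of_le_pow Nat.lt_two_pow_self.le
    have : (s : ℝ) ≤ n := by exact_mod_cast hle
    push_cast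
    nlinarith
  have h3 : (3 : ℝ) ≤ n ^ 2 := by nlinarith
  have h4 : (0 : ℝ) < (n : ℝ) ^ (-(2 * c + 6)) := Real.rpow_pos_of_pos hn0 _
  calc ((T + 1 : ℕ) : ℝ) * ((s + 1 : ℕ) * (3 * (n * (n : ℝ) ^ (-(2 * c + 6)))))
      ≤ (n * (n : ℝ) ^ c) * (n ^ 2 * (n ^ 2 * (n * (n : ℝ) ^ (-(2 * c + 6))))) := by gcongr
    _ = (n : ℝ) ^ 6 * ((n : ℝ) ^ c * (n : ℝ) ^ (-(2 * c + 6))) := by ring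
    _ = (n : ℝ) ^ (-c) := by
        rw [← Real.rpow_natCast, ← Real.rpow_add hn0, ← Real.rpow_add hn0]
        congr 1
        push_cast
        ring

end Parameters

end DynMatroid

open DynMatroid MeasureTheory in
theorem mainTheorem3 :
    ∀ c : ℝ, 0 < c → ∃ C : ℝ, 0 < C ∧
      ∀ (α : Type u) (n : ℕ) (ε : ℝ), 1 ≤ n → 0 < ε → ε < 1 / 2 →
        ∃ 𝒜 : DynMatroid.RandomizedAlgorithm α,
          (∀ (T : ℕ) (M : ℕ → Matroid α) (w : ℕ → DynMatroid.Update α),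
            DynMatroid.IsDynamicMatroid n T M w →
              ∀ ω : 𝒜.Seed, ∀ t < T,
                ((𝒜.run ω).updateQueries M w t : ℝ) ≤ C * Real.log n ^ 6 / ε ^ 8) ∧
          (∀ (T : ℕ) (M : ℕ → Matroid α) (w : ℕ → DynMatroid.Update α),
            DynMatroid.IsDynamicMatroid n T M w → (T : ℝ) ≤ (n : ℝ) ^ c →
              𝒜.law {ω | ¬ ∀ t ≤ T, DynMatroid.IsApprox ε ((𝒜.run ω).estimate M w t)
                  (DynMatroid.coveringNumber (M t))} ≤
                ENNReal.ofReal ((n : ℝ) ^ (-c))) := by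
  intro c hc
  set a : ℝ := 2 * c + 6 with ha
  set D : ℝ := 82944 * a + 1 with hD
  have hD0 : 0 < D := by positivity
  refine ⟨45 * D ^ 2, by positivity, fun α n ε hn hε hε2 => ?_⟩
  classical
  let _ : LinearOrder α := linearOrderOfSTO WellOrderingRel
  rcases hn.eq_or_lt with rfl | hn2
  · -- As `log 1 = 0`, no queries are allowed, and a failure probability of `1` is.
    refine ⟨{ Seed := α → unitInterval, law := labelLaw α,
              run := fun _ => ⟨PUnit, fun _ => .ret ⟨⟩, fun _ _ => .ret ⟨⟩, fun _ => 0⟩ }, ?_, ?_⟩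
    · intro T M w _ ω t _
      simp [Algorithm.updateQueries]
    · intro T M w _ _
      simpa using prob_le_one
  replace hn2 : 2 ≤ n := hn2
  have hl2 : Real.log 2 ≤ Real.log n := Real.log_le_log (by norm_num) (by exact_mod_cast hn2)
  have hlog2 := Real.log_two_gt_d9
  set l := Real.log n with hl
  have hl0 : 0 < l := by linarith
  -- `K` makes the failure probability of a Chernoff bound `n ^ (-a)`, and `k` bases suffice for
  -- covering numbers up to `16 K`.
  set δ : ℝ := ε / 3 with hδ
  set K : ℝ := 4 * a * l / δ ^ 2 with hK
  set k : ℕ := ⌈16 * (16 * K) * l / δ ^ 2⌉₊ with hk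
  set s : ℕ := Nat.clog 2 n with hs
  have hδ0 : 0 < δ := by positivity
  have hδ1 : δ ≤ 1 := by linarith
  have hK1 : 1 ≤ K := by
    rw [hK, le_div_iff₀ (by positivity)]
    nlinarith
  have hns : n ≤ 2 ^ s := Nat.le_pow_clog (by norm_num) n
  have hk0 : 0 < k := Nat.ceil_pos.2 (by positivity)
  have hkle : (k : ℝ) ≤ D * (l ^ 2 / ε ^ 4) := by
    have h1 := (Nat.ceil_lt_add_one (show 0 ≤ 16 * (16 * K) * l / δ ^ 2 by positivity)).le
    have h2 : 16 * (16 * K) * l / δ ^ 2 = 82944 * a * (l ^ 2 / ε ^ 4) := by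
      rw [hK, hδ]
      field_simp
      ring
    have h3 : 1 ≤ l ^ 2 / ε ^ 4 := by
      rw [le_div_iff₀ (by positivity), one_mul]
      have h4 : ε ^ 2 ≤ 1 / 4 := by nlinarith
      have h5 : 0 ≤ ε ^ 2 := by positivity
      nlinarith
    rw [← hk, h2] at h1
    rw [hD, add_mul, one_mul]
    linarith
  have hexp : Real.exp (-(δ ^ 2 * K / 4)) = (n : ℝ) ^ (-a) := by
    rw [Real.rpow_def_of_pos (by positivity), hK]
    congr 1
    field_simp
    rw [hl]
  have hq : n * Real.exp (-(δ ^ 2 * K / 4)) ≤ 1 := by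
    rw [hexp, ← Real.rpow_one_add' (by positivity) (by linarith)]
    exact Real.rpow_le_one_of_one_le_of_nonpos (by exact_mod_cast hn) (by linarith)
  refine ⟨{ Seed := α → unitInterval, law := labelLaw α,
            run := fun ω => packingAlgorithm ω (s + 1) s k (8 * K) }, ?_, ?_⟩
  · intro T M w h ω t ht
    refine le_trans ?_ (query_bound hn2 hs hε hD0 hk0 hkle)
    exact_mod_cast updateQueries_packingAlgorithm_le ω h hns ht
  · intro T M w h hT
    calc _ ≤ labelLaw α (⋃ t ∈ Finset.range (T + 1), {ω | ¬ IsApprox ε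
            ((packingAlgorithm ω (s + 1) s k (8 * K)).estimate M w t)
            (coveringNumber (M t))}) := by
          refine measure_mono fun ω hω => ?_
          simp only [Set.mem_ofPred_eq, not_forall] at hω
          obtain ⟨t, ht, hω⟩ := hω
          exact Set.mem_biUnion (Finset.mem_coe.2 (Finset.mem_range.2 (Nat.lt_succ_of_le ht))) hω
      _ ≤ ∑ t ∈ Finset.range (T + 1),
            ENNReal.ofReal ((s + 1 : ℕ) * (3 * (n * Real.exp (-(δ ^ 2 * K / 4))))) := by
          refine (measure_biUnion_finset_le _ _).trans (Finset.sum_le_sum fun t ht => ?_)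
          have htT : t ≤ T := Nat.le_of_lt_succ (Finset.mem_range.1 ht)
          obtain ⟨E, hE, hEn⟩ := exists_ground_eq h htT
          simp only [Algorithm.estimate, state_packingAlgorithm _ h hns t htT E hE]
          exact measure_not_isApprox_le hE hEn hn hns hK1 hε hε2 hδ hk0 (Nat.le_ceil _) hq
      _ ≤ ENNReal.ofReal ((n : ℝ) ^ (-c)) := by
          rw [Finset.sum_const, Finset.card_range, nsmul_eq_mul, ← ENNReal.ofReal_natCast,
            ← ENNReal.ofReal_mul (Nat.cast_nonneg _), hexp]
          exact ENNReal.ofReal_le_ofReal (failure_bound hn2 hs hc hT)
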